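/- Conventions. Borel spaces are standard. A Borel groupoid is a groupoid $G$ with unit space $X=G^{(0)}$, range and source maps $r,s:G\to X$, with (standard) Borel structures for which all operations are Borel; $\gamma_1\gamma_2$ is defined when $s(\gamma_1)=r(\gamma_2)$. A measured groupoid $(G,C)$ is a Borel groupoid with a measure class $C$ (containing a probability measure) that is symmetric (invariant under $\gamma\mapsto\gamma^{-1}$) and invariant: for some probability measure $\nu\in C$ with disintegration $(\nu^x)_{x\in X}$ along $r$ there is an $r(C)$-conull Borel set $U\subset X$ such that $\gamma\nu^{s(\gamma)}$ is equivalent to $\nu^{r(\gamma)}$ for all $\gamma\in G|_U=\{\gamma: r(\gamma),s(\gamma)\in U\}$; here $r(C)$ is the class of $r_*\nu$. For a conull Borel set $U$, $G|_U$ is called an inessential reduction. $(G,C)$ is ergodic if every Borel set $A\subset X$ that is invariant ($r(\gamma)\in A\iff s(\gamma)\in A$) is $r(C)$-null or $r(C)$-conull, and $r$-discrete if the fibres of $r$ are countable on some inessential reduction. $C^{(2)}$ is the class of the image of $\int\nu^x\times\nu^x\,d(r_*\nu)(x)$ under $(\gamma_1,\gamma_2)\mapsto(\gamma_1^{-1},\gamma_2)$,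 on the set of composable pairs. A Hilbert bundle over $X$ is a family $\mathcal H=(\mathcal H(x))_{x\in X}$ of (real or complex, separable) Hilbert spaces with a standard Borel structure on its total space $\{(x,v):v\in\mathcal H(x)\}$ such that $E\subset X$ is Borel iff its preimage is, and such that there is a sequence of Borel sections $\xi_n$ for which the functions $(x,v)\mapsto\langle\xi_n(x),v\rangle$ and $x\mapsto\langle\xi_m(x),\xi_n(x)\rangle$ are Borel and the former separate the points of each fibre. A representation $L$ of $(G,C)$ in $\mathcal H$ is a Borel family of operators $L(\gamma):\mathcal H(s(\gamma))\to\mathcal H(r(\gamma))$, $\gamma \in G$, whose restriction to some inessential reduction consists of surjective linear isometries with $L(\gamma_1\gamma_2)=L(\gamma_1)L(\gamma_2)$ and $L(x)=\mathrm{id}$ at units. A unit section is a Borel section $\xi$ with $\|\xi(x)\|=1$ a.e. $(G,C)$ has property $T$ if every representation $L$ in a complex Hilbert bundle for which there are unit sections $\xi_n$ with $\|\xi_n(r(\gamma))-L(\gamma)\xi_n(s(\gamma))\|\to0$ for $C$-a.e. $\gamma$ has a unit section $\xi$ with $\xi(r(\gamma))=L(\gamma)\xi(s(\gamma))$ for $C$-a.e.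 $\gamma$. An a.e. $L$-cocycle is a Borel map $\gamma\mapsto b(\gamma)\in\mathcal H(r(\gamma))$ with $b(\gamma_1\gamma_2)=b(\gamma_1)+L(\gamma_1)b(\gamma_2)$ for $C^{(2)}$-a.e. $(\gamma_1,\gamma_2)$; it is a coboundary if there is a Borel section $\xi$ of $\mathcal H$ with $b(\gamma)=\xi(r(\gamma))-L(\gamma)\xi(s(\gamma))$ for $C$-a.e. $\gamma$. $H^1((G,C),L)$ is the group of a.e. cocycles (identified when equal $C$-a.e.) modulo coboundaries. Theorem. Let $(G,C)$ be an ergodic $r$-discrete measured groupoid with property $T$. Then $H^1((G,C),L)=0$ for every representation $L$ of $(G,C)$ in a real or complex Hilbert bundle. In other words, every action of $(G,C)$ by affine isometries on a Hilbert bundle $\mathcal H$, that is, every Borel family of maps $\alpha(\gamma):\mathcal H(s(\gamma))\to\mathcal H(r(\gamma))$ that on some inessential reduction are surjective affine isometries with $\alpha(\gamma_1\gamma_2)=\alpha(\gamma_1)\alpha(\gamma_2)$ and $\alpha(x)=\mathrm{id}$ at units, has an invariant section: a Borel section $\xi$ with $\alpha(\gamma)\xi(s(\gamma))=\xi(r(\gamma))$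 for $C$-a.e. $\gamma$. -/

import Mathlib

open MeasureTheory ProbabilityTheory CategoryTheory Filter Topology

universe k w u v

noncomputable section

namespace MeasuredGroupoid

/-! ## Borel groupoids

A groupoid with unit space `X` is a Mathlib groupoid structure on `X`, and the set `G` of its
elements is the type of all arrows.  An element `γ : x ⟶ y` has range `x` and source `y`, so that
the product `γ₁ γ₂`, defined when `s(γ₁) = r(γ₂)`, is the composition `γ₁ ≫ γ₂`. -/

/-- The set `G` of all elements of the groupoid with unit space `X`. -/
abbrev Arr (X : Type u) [Groupoid.{v} X] := Quiver.Total X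

section Groupoid

variable {X : Type u} [Groupoid.{v} X]

/-- The range `r(γ)`. -/
abbrev Arr.r (γ : Arr X) : X := γ.left

/-- The source `s(γ)`. -/
abbrev Arr.s (γ : Arr X) : X := γ.right

/-- The unit at `x`. -/
def Arr.unit (x : X) : Arr X := ⟨x, x, 𝟙 x⟩

/-- The inverse `γ⁻¹`. -/
def Arr.inv (γ : Arr X) : Arr X := ⟨γ.s, γ.r, Groupoid.inv γ.hom⟩

/-- The product `γ η` of a composable pair. -/
def Arr.mul (γ η : Arr X) (h : γ.s = η.r) : Arr X :=
  ⟨γ.r, η.s, γ.hom ≫ eqToHom h ≫ η.hom⟩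

/-- A Borel groupoid: all the operations are Borel maps. -/
class BorelGroupoid (X : Type u) [MeasurableSpace X] [Groupoid.{v} X]
    [MeasurableSpace (Arr X)] : Prop where
  measurable_r : Measurable (Arr.r : Arr X → X)
  measurable_s : Measurable (Arr.s : Arr X → X)
  measurable_unit : Measurable (Arr.unit : X → Arr X)
  measurable_inv : Measurable (Arr.inv : Arr X → Arr X)
  measurable_mul : Measurable
    (fun p : {p : Arr X × Arr X // p.1.s = p.2.r} => Arr.mul p.1.1 p.1.2 p.2)

/-! ## Measured groupoids

A measure class `C` on `G` is represented by a probability measure `ν` in it: it consists of the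
measures having the same null sets as `ν`. -/

/-- Two measures are equivalent if they have the same null sets. -/
def MeasureEquiv {Y : Type*} [MeasurableSpace Y] (μ ν : Measure Y) : Prop :=
  μ ≪ ν ∧ ν ≪ μ

variable [MeasurableSpace X] [MeasurableSpace (Arr X)]

/-- The image `r_* ν`, a representative of the class `r(C)`. -/
def baseMeasure (ν : Measure (Arr X)) : Measure X := ν.map Arr.r

/-- `U` is a Borel set of units that is conull for `r(C)`.  Such sets define the inessential
reductions of the measured groupoid, consisting of all `γ` with `r(γ), s(γ) ∈ U`. -/
def IsConull (ν : Measure (Arr X)) (U : Set X) : Prop :=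
  MeasurableSet U ∧ baseMeasure ν Uᶜ = 0

/-- The disintegration `x ↦ ν^x` of `ν` with respect to `r : G → X`. -/
def fiberMeasure [StandardBorelSpace (Arr X)] (ν : Measure (Arr X)) [IsProbabilityMeasure ν] :
    Kernel X (Arr X) :=
  haveI : Nonempty (Arr X) := nonempty_of_isProbabilityMeasure ν
  condDistrib id Arr.r ν

/-- The left translate `γ ρ` of a measure `ρ` carried by `{η | r(η) = s(γ)}`. -/
def leftTranslate (γ : Arr X) (ρ : Measure (Arr X)) : Measure (Arr X) :=
  (ρ.comap (Subtype.val : {η : Arr X // γ.s = η.r} → Arr X)).map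
    (fun η => Arr.mul γ η.1 η.2)

/-- The class of `ν` is symmetric and (left) invariant, so that it defines a measured groupoid. -/
structure IsMeasuredGroupoid [StandardBorelSpace (Arr X)] (ν : Measure (Arr X)) : Prop where
  symmetric : MeasureEquiv ν (ν.map Arr.inv)
  invariant : ∃ (ν' : Measure (Arr X)) (_ : IsProbabilityMeasure ν'), MeasureEquiv ν' ν ∧
    ∃ U : Set X, IsConull ν U ∧ ∀ γ : Arr X, γ.r ∈ U → γ.s ∈ U →
      MeasureEquiv (leftTranslate γ (fiberMeasure ν' γ.s)) (fiberMeasure ν' γ.r)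

/-- Ergodicity: an invariant Borel set of units is null or conull. -/
def IsErgodic (ν : Measure (Arr X)) : Prop :=
  ∀ A : Set X, MeasurableSet A → (∀ γ : Arr X, γ.r ∈ A ↔ γ.s ∈ A) →
    baseMeasure ν A = 0 ∨ baseMeasure ν Aᶜ = 0

/-- `r`-discreteness: in some inessential reduction, the fibres of `r` are countable. -/
def IsRDiscrete (ν : Measure (Arr X)) : Prop :=
  ∃ U : Set X, IsConull ν U ∧ ∀ x ∈ U, {γ : Arr X | γ.r = x ∧ γ.s ∈ U}.Countable

/-- A representative of the class `C^{(2)}` on the set of composable pairs: the image of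
`∫ ν^x × ν^x d(r_* ν)(x)` under `(γ₁, γ₂) ↦ (γ₁⁻¹, γ₂)`. -/
def pairMeasure [StandardBorelSpace (Arr X)] (ν : Measure (Arr X)) [IsProbabilityMeasure ν] :
    Measure (Arr X × Arr X) :=
  ((baseMeasure ν).bind (fiberMeasure ν ×ₖ fiberMeasure ν)).map (Prod.map Arr.inv id)

end Groupoid

/-! ## Hilbert bundles -/

/-- A Hilbert bundle over the Borel space `X`: a family of Hilbert spaces together with a standard
Borel structure on the total space such that a subset of `X` is Borel if and only if its preimage
is, and with a fundamental sequence of sections. -/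
structure HilbertBundle (𝕜 : Type k) [RCLike 𝕜] (X : Type u) [MeasurableSpace X] where
  /-- The fibres. -/
  Fiber : X → Type w
  normed : ∀ x, NormedAddCommGroup (Fiber x)
  innerProduct : ∀ x, InnerProductSpace 𝕜 (Fiber x)
  complete : ∀ x, CompleteSpace (Fiber x)
  /-- The Borel structure on the total space. -/
  borel : MeasurableSpace (Σ x, Fiber x)
  standard : StandardBorelSpace (Σ x, Fiber x)
  measurableSet_iff : ∀ E : Set X,
    MeasurableSet E ↔ MeasurableSet (Sigma.fst ⁻¹' E : Set (Σ x, Fiber x))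
  /-- The fundamental sequence. -/
  fund : ℕ → ∀ x, Fiber x
  measurable_fund : ∀ n, Measurable fun x => (⟨x, fund n x⟩ : Σ x, Fiber x)
  measurable_inner : ∀ n, Measurable fun z : (Σ x, Fiber x) => inner 𝕜 (fund n z.1) z.2
  measurable_gram : ∀ m n, Measurable fun x => inner 𝕜 (fund m x) (fund n x)
  separating : ∀ (x : X) (v v' : Fiber x),
    (∀ n, inner 𝕜 (fund n x) v = inner 𝕜 (fund n x) v') → v = v'

attribute [instance] HilbertBundle.normed HilbertBundle.innerProduct HilbertBundle.complete

namespace HilbertBundle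

variable {𝕜 : Type k} [RCLike 𝕜] {X : Type u} [MeasurableSpace X] (H : HilbertBundle.{k, w} 𝕜 X)

/-- The total space `X * H`. -/
def Total : Type (max u w) := Σ x, H.Fiber x

instance : MeasurableSpace H.Total := H.borel

instance : StandardBorelSpace H.Total := H.standard

/-- The point `(x, v)` of the total space. -/
def pt (x : X) (v : H.Fiber x) : H.Total := ⟨x, v⟩

/-- Borel sections of the bundle. -/
def IsSection (ξ : ∀ x, H.Fiber x) : Prop := Measurable fun x => H.pt x (ξ x)

/-- Borel sections `y ↦ f y ∈ H(p(y))` of the pull-back of the bundle along `p`. -/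
def IsPullbackSection {Y : Type*} [MeasurableSpace Y] (p : Y → X) (f : ∀ y, H.Fiber (p y)) :
    Prop :=
  Measurable fun y => H.pt (p y) (f y)

variable {H}

theorem isPullbackSection_iff [StandardBorelSpace X] {Y : Type*} [MeasurableSpace Y] {p : Y → X}
    {f : ∀ y, H.Fiber (p y)} :
    H.IsPullbackSection p f ↔
      Measurable p ∧ ∀ n, Measurable fun y => inner 𝕜 (H.fund n (p y)) (f y) := by
  have hfst : Measurable (fun z : H.Total => z.1) := by
    intro E hE
    exact (H.measurableSet_iff E).1 hE
  have hin : ∀ n, Measurable (fun z : H.Total => inner 𝕜 (H.fund n z.1) z.2) :=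
    H.measurable_inner
  let F : H.Total → X × (ℕ → 𝕜) := fun z => (z.1, fun n => inner 𝕜 (H.fund n z.1) z.2)
  have hF : Measurable F := hfst.prodMk (measurable_pi_lambda _ hin)
  have hinj : Function.Injective F := by
    rintro ⟨x, a⟩ ⟨y, c⟩ h
    obtain rfl : x = y := congrArg Prod.fst h
    have h2 := congrArg Prod.snd h
    obtain rfl : a = c := H.separating x a c fun n => congrFun h2 n
    rfl
  constructor
  · intro h
    have hF' : Measurable fun y => F (H.pt (p y) (f y)) := hF.comp h
    exact ⟨hF'.fst, fun n => (measurable_pi_apply n).comp hF'.snd⟩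
  · rintro ⟨h1, h2⟩
    change Measurable fun y => H.pt (p y) (f y)
    refine (hF.measurableEmbedding hinj).measurable_comp_iff.1 ?_
    exact h1.prodMk (measurable_pi_lambda _ h2)

theorem isSection_iff [StandardBorelSpace X] {ξ : ∀ x, H.Fiber x} :
    H.IsSection ξ ↔ ∀ n, Measurable fun x => inner 𝕜 (H.fund n x) (ξ x) :=
  (isPullbackSection_iff (p := fun x => x)).trans (and_iff_right measurable_id)

end HilbertBundle

/-! ## Representations, property T, first cohomology -/

variable {𝕜 : Type k} [RCLike 𝕜] {X : Type u} [MeasurableSpace X] [Groupoid.{v} X]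
  [MeasurableSpace (Arr X)]

/-- A representation of the measured groupoid in the Hilbert bundle `H`: a Borel map
`γ ↦ L(γ) : H(s(γ)) → H(r(γ))` whose restriction to some inessential reduction is a homomorphism
into Hilbert space isomorphisms.  Outside of that reduction the operators are arbitrary. -/
structure GroupoidRep (ν : Measure (Arr X)) (H : HilbertBundle.{k, w} 𝕜 X) where
  /-- The operators `L(γ)`. -/
  op : ∀ {x y : X}, (x ⟶ y) → (H.Fiber y →L[𝕜] H.Fiber x)
  measurable_op : ∀ m n, Measurable fun γ : Arr X =>
    inner 𝕜 (op γ.hom (H.fund n γ.s)) (H.fund m γ.r)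
  strict : ∃ U : Set X, IsConull ν U ∧
    (∀ x ∈ U, ∀ y ∈ U, ∀ g : x ⟶ y,
      ∃ e : H.Fiber y ≃ₗᵢ[𝕜] H.Fiber x, ∀ a, op g a = e a) ∧
    (∀ x ∈ U, ∀ a, op (𝟙 x) a = a) ∧
    (∀ x ∈ U, ∀ y ∈ U, ∀ z ∈ U, ∀ (g : x ⟶ y) (h : y ⟶ z) (a : H.Fiber z),
      op (g ≫ h) a = op g (op h a))

namespace GroupoidRep

variable {ν : Measure (Arr X)} {H : HilbertBundle.{k, w} 𝕜 X} (L : GroupoidRep ν H)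

/-- The coboundary `c_L(ξ) : γ ↦ ξ(r(γ)) - L(γ) ξ(s(γ))`. -/
def coboundary (ξ : ∀ x, H.Fiber x) (γ : Arr X) : H.Fiber γ.r := ξ γ.r - L.op γ.hom (ξ γ.s)

end GroupoidRep

/-- Unit sections: Borel sections of norm one almost everywhere. -/
def IsUnitSection (ν : Measure (Arr X)) (H : HilbertBundle.{k, w} 𝕜 X) (ξ : ∀ x, H.Fiber x) :
    Prop :=
  H.IsSection ξ ∧ ∀ᵐ x ∂(baseMeasure ν), ‖ξ x‖ = 1

namespace GroupoidRep

variable {ν : Measure (Arr X)} {H : HilbertBundle.{k, w} 𝕜 X} (L : GroupoidRep ν H)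

/-- `L` contains a unit invariant section. -/
def HasUnitInvariantSection : Prop :=
  ∃ ξ : ∀ x, H.Fiber x, IsUnitSection ν H ξ ∧
    ∀ᵐ γ ∂ν, ξ γ.r = L.op γ.hom (ξ γ.s)

/-- `L` almost contains unit invariant sections. -/
def AlmostHasUnitInvariantSections : Prop :=
  ∃ ξ : ℕ → ∀ x, H.Fiber x, (∀ n, IsUnitSection ν H (ξ n)) ∧
    ∀ᵐ γ ∂ν, Tendsto (fun n => ‖L.coboundary (ξ n) γ‖) atTop (𝓝 0)

end GroupoidRep

/-- Property T: every representation in a complex Hilbert bundle that almost contains unit invariant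
sections contains a unit invariant section. The fibres range over the universe `w`; since they are
separable, every Hilbert bundle is isomorphic to one with fibres in any given universe. -/
def HasPropertyT (ν : Measure (Arr X)) : Prop :=
  ∀ (H : HilbertBundle.{0, w} ℂ X) (L : GroupoidRep ν H),
    L.AlmostHasUnitInvariantSections → L.HasUnitInvariantSection

namespace GroupoidRep

variable {ν : Measure (Arr X)} {H : HilbertBundle.{k, w} 𝕜 X} (L : GroupoidRep ν H)

/-- The identity `b(γ₁γ₂) = b(γ₁) + L(γ₁) b(γ₂)` at the composable pair `p = (γ₁, γ₂)`. -/
def CocycleIdentity (b : ∀ γ : Arr X, H.Fiber γ.r) (p : Arr X × Arr X) : Prop :=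
  ∀ (x y z : X) (g : x ⟶ y) (h : y ⟶ z), p = (⟨x, y, g⟩, ⟨y, z, h⟩) →
    b ⟨x, z, g ≫ h⟩ = b ⟨x, y, g⟩ + L.op g (b ⟨y, z, h⟩)

variable [StandardBorelSpace X] [StandardBorelSpace (Arr X)] [BorelGroupoid X]
  [IsProbabilityMeasure ν]

/-- The almost everywhere `L`-cocycles: Borel sections of the pull-back of `H` along `r` which
satisfy the cocycle identity almost everywhere with respect to `C^{(2)}`. -/
def cocycles : Submodule 𝕜 (∀ γ : Arr X, H.Fiber γ.r) where
  carrier := {b | H.IsPullbackSection Arr.r b ∧ ∀ᵐ p ∂(pairMeasure ν), L.CocycleIdentity b p}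
  zero_mem' := by
    refine ⟨HilbertBundle.isPullbackSection_iff.2 ⟨BorelGroupoid.measurable_r, fun n => ?_⟩, ?_⟩
    · simp
    · exact Eventually.of_forall fun p x y z g h _ => by simp
  add_mem' := by
    rintro b c ⟨hb, hb'⟩ ⟨hc, hc'⟩
    rw [HilbertBundle.isPullbackSection_iff] at hb hc
    refine ⟨HilbertBundle.isPullbackSection_iff.2 ⟨hb.1, fun n => ?_⟩, ?_⟩
    · simpa only [Pi.add_apply, inner_add_right] using (hb.2 n).fun_add (hc.2 n)
    · filter_upwards [hb', hc'] with p h1 h2 x y z g h hp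
      simp only [Pi.add_apply, h1 x y z g h hp, h2 x y z g h hp, map_add]
      abel
  smul_mem' := by
    rintro t b ⟨hb, hb'⟩
    rw [HilbertBundle.isPullbackSection_iff] at hb
    refine ⟨HilbertBundle.isPullbackSection_iff.2 ⟨hb.1, fun n => ?_⟩, ?_⟩
    · simpa [inner_smul_right] using (hb.2 n).const_mul t
    · filter_upwards [hb'] with p h1 x y z g h hp
      simp only [Pi.smul_apply, h1 x y z g h hp, map_smul, smul_add]

/-- The `L`-coboundaries: the cocycles that are almost everywhere equal to `c_L(ξ)` for some Borel
section `ξ`. In particular cocycles that vanish almost everywhere are coboundaries, so that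
the quotient of the cocycles by the coboundaries is unchanged if one first identifies cocycles that
are almost everywhere equal. -/
def coboundaries : Submodule 𝕜 L.cocycles where
  carrier := {b | ∃ ξ : ∀ x, H.Fiber x, H.IsSection ξ ∧ ∀ᵐ γ ∂ν, b.1 γ = L.coboundary ξ γ}
  zero_mem' := by
    refine ⟨0, HilbertBundle.isSection_iff.2 fun n => ?_,
      Eventually.of_forall fun γ => ?_⟩
    · simp
    · simp [coboundary]
  add_mem' := by
    rintro b c ⟨ξ, hξ, hb⟩ ⟨η, hη, hc⟩
    have hξ' := HilbertBundle.isSection_iff.1 hξ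
    have hη' := HilbertBundle.isSection_iff.1 hη
    refine ⟨ξ + η, HilbertBundle.isSection_iff.2 fun n => ?_, ?_⟩
    · simpa only [Pi.add_apply, inner_add_right] using (hξ' n).fun_add (hη' n)
    · filter_upwards [hb, hc] with γ h1 h2
      simp only [Submodule.coe_add, Pi.add_apply, h1, h2, coboundary, map_add]
      abel
  smul_mem' := by
    rintro t b ⟨ξ, hξ, hb⟩
    have hξ' := HilbertBundle.isSection_iff.1 hξ
    refine ⟨t • ξ, HilbertBundle.isSection_iff.2 fun n => ?_, ?_⟩
    · simpa [inner_smul_right] using (hξ' n).const_mul t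
    · filter_upwards [hb] with γ h1
      simp only [Submodule.coe_smul, Pi.smul_apply, h1, coboundary, map_smul, smul_sub]

/-- The first cohomology group `H¹((G, C), L)`. -/
abbrev H1 : Type _ := L.cocycles ⧸ L.coboundaries

end GroupoidRep

/-- An action of the measured groupoid by affine isometries on the Hilbert bundle `H`:  maps
`α(γ) : H(s(γ)) → H(r(γ))` depending in a Borel way on `γ`, in the sense that `γ ↦ α(γ) ξ(s(γ))` is
Borel for every Borel section `ξ`, which form on some inessential reduction a homomorphism into
surjective affine isometries. Outside of that reduction the maps are arbitrary. -/
structure AffineAction (ν : Measure (Arr X)) (H : HilbertBundle.{k, w} 𝕜 X) where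
  /-- The maps `α(γ)`. -/
  act : ∀ {x y : X}, (x ⟶ y) → H.Fiber y → H.Fiber x
  measurable_act : ∀ ξ : ∀ x, H.Fiber x, H.IsSection ξ →
    H.IsPullbackSection (Arr.r : Arr X → X) fun γ => act γ.hom (ξ γ.s)
  strict : ∃ U : Set X, IsConull ν U ∧
    (∀ x ∈ U, ∀ y ∈ U, ∀ g : x ⟶ y,
      ∃ e : H.Fiber y ≃ᵃⁱ[𝕜] H.Fiber x, ∀ a, act g a = e a) ∧
    (∀ x ∈ U, ∀ a, act (𝟙 x) a = a) ∧
    (∀ x ∈ U, ∀ y ∈ U, ∀ z ∈ U, ∀ (g : x ⟶ y) (h : y ⟶ z) (a : H.Fiber z),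
      act (g ≫ h) a = act g (act h a))

/-- The affine action has an invariant Borel section. -/
def AffineAction.HasInvariantSection {ν : Measure (Arr X)} {H : HilbertBundle.{k, w} 𝕜 X}
    (α : AffineAction ν H) : Prop :=
  ∃ ξ : ∀ x, H.Fiber x, H.IsSection ξ ∧ ∀ᵐ γ ∂ν, α.act γ.hom (ξ γ.s) = ξ γ.r

end MeasuredGroupoid

end

open MeasuredGroupoid

/-!
# Affine actions of groupoids with property T have invariant sections

Let `α` be an action of `(G, C)` by affine isometries on a Hilbert bundle `H`. For a Hilbert
space `V`, the Gaussian kernels `exp (-‖v - w‖² / (n + 1))` on `V`, `n : ℕ`, are positive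
semidefinite by Schur's product theorem (`posSemidef_gaussKernel`); so there is a Hilbert space
spanned by unit vectors `e (n, v)`, orthogonal for different `n`, with these inner products. Applied
to the fibres of `H`, this gives a complex Hilbert bundle over `X` with fibres in `Type`
(`exists_gaussBundle`), in which `α` induces the representation `e (n, v) ↦ e (n, α(γ) v)`
(`AffineAction.exists_gaussRep`). The unit sections `e (n, 0)` are almost invariant as `n → ∞`,
because `exp (-‖α(γ) 0‖² / (n + 1)) → 1`. Property T provides an invariant unit section `η`.

The functions `f_x (n, v) = ⟨e (n, v), η x⟩` satisfy `f_{r(γ)} (n, α(γ) v) = f_{s(γ)} (n, v)` for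
almost every `γ`. Moreover `f_x` tends to zero at infinity of `H(x)`, uniformly in `n`
(`tendsto_inner_gaussVec`), since this holds for the vectors that span the Hilbert space, and it is
not identically zero. Hence the sets `{v | ∃ n, |f_x (n, v)| > 1 / (k + 1)}` are bounded, open and
permuted by the action, and the first one of them that is not empty has a circumcenter. The
circumcenters form a Borel section (`HilbertBundle.isSection_circumcenter`), which is invariant
because affine isometries preserve circumcenters
(`AffineAction.hasInvariantSection_of_hasPropertyT`).

The vanishing of the first cohomology follows once an almost everywhere cocycle `b` is known to be
a genuine cocycle on an inessential reduction, as `v ↦ L(γ) v + b(γ)` is then an affine action and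
its invariant sections exhibit `b` as a coboundary. This step uses `r`-discreteness: after an
inessential reduction every `γ` is an atom of the fibre measure `ν^{r(γ)}`
(`exists_conull_fiberMeasure_ne_zero`), so that an identity which holds almost everywhere holds
everywhere there (`exists_conull_cocycle`).
-/

noncomputable section

/-! ### Combinations with coefficients in a countable dense set -/

/-- The linear combination of the vectors `e i` whose coefficients, taken from a fixed dense
sequence of scalars, are listed by `l`. -/
def ratComb (𝕜 : Type*) [RCLike 𝕜] {E : Type*} [AddCommMonoid E] [Module 𝕜 E]
    (e : ℕ → E) (l : List (ℕ × ℕ)) : E :=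
  (l.map fun p => TopologicalSpace.denseSeq 𝕜 p.1 • e p.2).sum

section RatComb

variable {𝕜 : Type*} [RCLike 𝕜] {E : Type*} [NormedAddCommGroup E]

@[simp] theorem ratComb_nil [Module 𝕜 E] (e : ℕ → E) : ratComb 𝕜 e [] = 0 := rfl

theorem ratComb_cons [Module 𝕜 E] (e : ℕ → E) (p : ℕ × ℕ) (l : List (ℕ × ℕ)) :
    ratComb 𝕜 e (p :: l) = TopologicalSpace.denseSeq 𝕜 p.1 • e p.2 + ratComb 𝕜 e l := by
  simp [ratComb]

theorem ratComb_append [Module 𝕜 E] (e : ℕ → E) (l l' : List (ℕ × ℕ)) :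
    ratComb 𝕜 e (l ++ l') = ratComb 𝕜 e l + ratComb 𝕜 e l' := by
  simp [ratComb]

theorem map_ratComb [Module 𝕜 E] {F : Type*} [NormedAddCommGroup F] [Module 𝕜 F]
    (T : E →ₗ[𝕜] F) (e : ℕ → E) (l : List (ℕ × ℕ)) :
    T (ratComb 𝕜 e l) = ratComb 𝕜 (fun i => T (e i)) l := by
  simp [ratComb, map_list_sum, Function.comp_def]

theorem span_subset_closure_ratComb [NormedSpace 𝕜 E] (e : ℕ → E) :
    (Submodule.span 𝕜 (Set.range e) : Set E) ⊆ closure (Set.range (ratComb 𝕜 e)) := by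
  have hadd : ∀ a ∈ closure (Set.range (ratComb 𝕜 e)), ∀ b ∈ closure (Set.range (ratComb 𝕜 e)),
      a + b ∈ closure (Set.range (ratComb 𝕜 e)) := by
    intro a ha b hb
    refine map_mem_closure₂ continuous_add ha hb ?_
    rintro _ ⟨l, rfl⟩ _ ⟨l', rfl⟩
    exact ⟨l ++ l', ratComb_append e l l'⟩
  intro v hv
  rw [SetLike.mem_coe, Finsupp.mem_span_range_iff_exists_finsupp] at hv
  obtain ⟨c, rfl⟩ := hv
  refine Finset.sum_induction _ (· ∈ closure (Set.range (ratComb 𝕜 e)))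
    (fun a b ha hb => hadd a ha b hb) (subset_closure ⟨[], rfl⟩) fun i _ => ?_
  have h1 : c i ∈ closure (Set.range (TopologicalSpace.denseSeq 𝕜)) :=
    TopologicalSpace.denseRange_denseSeq 𝕜 (c i)
  refine map_mem_closure (f := fun z : 𝕜 => z • e i) (by fun_prop) h1 ?_
  rintro _ ⟨n, rfl⟩
  exact ⟨[(n, i)], by simp [ratComb]⟩

theorem denseRange_ratComb [NormedSpace 𝕜 E] {e : ℕ → E}
    (he : Dense (Submodule.span 𝕜 (Set.range e) : Set E)) : DenseRange (ratComb 𝕜 e) := by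
  have h := he.mono (span_subset_closure_ratComb e)
  rw [dense_iff_closure_eq, closure_closure] at h
  exact dense_iff_closure_eq.2 h

end RatComb

/-! ### Gaussian kernels -/

section Kernel

open Matrix
open scoped ComplexOrder

variable {ι : Type*}

/-- The version of `Matrix.posSemidef_gram` for infinite families. -/
theorem posSemidef_inner {V : Type*} [NormedAddCommGroup V] [InnerProductSpace ℝ V] (f : ι → V) :
    (Matrix.of fun i j => inner ℝ (f i) (f j)).PosSemidef := by
  refine ⟨?_, fun x => ?_⟩
  · ext i j
    simp [real_inner_comm]
  · have h : (x.sum fun i xi => x.sum fun j xj =>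
        star xi * (Matrix.of fun i j => inner ℝ (f i) (f j)) i j * xj) =
        inner ℝ (x.sum fun i xi => xi • f i) (x.sum fun i xi => xi • f i) := by
      simp only [Finsupp.sum, sum_inner, inner_sum, real_inner_smul_left, real_inner_smul_right,
        star_trivial, of_apply]
      refine Finset.sum_congr rfl fun i _ => Finset.sum_congr rfl fun j _ => ?_
      rw [real_inner_comm]
      ring
    rw [h]
    exact real_inner_self_nonneg

/-- The Schur exponential of a positive semidefinite matrix is positive semidefinite, being the
limit of the Schur polynomials of the exponential series. -/
theorem posSemidef_exp {A : Matrix ι ι ℝ} (hA : A.PosSemidef) :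
    (Matrix.of fun i j => Real.exp (A i j)).PosSemidef := by
  have hpow : ∀ k : ℕ, (Matrix.of fun i j => A i j ^ k).PosSemidef := by
    intro k
    induction k with
    | zero =>
      have h := posSemidef_inner (fun _ : ι => (1 : ℝ))
      simpa using h
    | succ k ih =>
      have h : (Matrix.of fun i j => A i j ^ (k + 1)) = (Matrix.of fun i j => A i j ^ k) ⊙ A := by
        ext i j
        simp [pow_succ]
      rw [h]
      exact ih.hadamard hA
  refine ⟨?_, fun x => ?_⟩
  · ext i j
    have := hA.isHermitian.apply i j
    simp only [star_trivial] at this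
    simp [this]
  · have h1 : HasSum (fun k : ℕ => x.sum fun i xi => x.sum fun j xj =>
        star xi * (A i j ^ k / k.factorial) * xj)
        (x.sum fun i xi => x.sum fun j xj => star xi * Real.exp (A i j) * xj) := by
      refine hasSum_sum fun i _ => hasSum_sum fun j _ => ?_
      refine HasSum.mul_right _ (HasSum.mul_left _ ?_)
      rw [Real.exp_eq_exp_ℝ]
      exact NormedSpace.exp_series_hasSum_exp' (𝕂 := ℝ) (A i j) |>.congr_fun (by
        intro k; simp [div_eq_inv_mul])
    refine h1.nonneg fun k => ?_
    have := ((hpow k).smul (a := ((k.factorial : ℝ)⁻¹)) (by positivity)).2 x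
    simpa [div_eq_inv_mul] using this

theorem posSemidef_map_ofReal {A : Matrix ι ι ℝ} (hA : A.PosSemidef) :
    (A.map (fun t => (t : ℂ))).PosSemidef := by
  have hs : ∀ i j, A i j = A j i := fun i j => by simpa using (hA.isHermitian.apply j i)
  have hH : (A.map (fun t => (t : ℂ))).IsHermitian := by
    ext i j
    simp [hs i j]
  refine ⟨hH, fun x => ?_⟩
  rw [Complex.le_def]
  have hre : ∀ f : ℂ → ℝ, f 0 = 0 →
      0 ≤ ∑ i ∈ x.support, ∑ j ∈ x.support, f (x i) * A i j * f (x j) := by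
    intro f hf
    have h := hA.2 (x.mapRange f hf)
    rw [Finsupp.sum_mapRange_index (by simp)] at h
    refine h.trans_eq (Finset.sum_congr rfl fun i _ => ?_)
    exact Finsupp.sum_mapRange_index (by simp)
  -- The quadratic form at `x` is the sum of the real forms at the real and imaginary parts of `x`.
  constructor
  · refine (add_nonneg (hre Complex.re rfl) (hre Complex.im rfl)).trans_eq ?_
    simp only [Finsupp.sum, Complex.re_sum, ← Finset.sum_add_distrib]
    refine Finset.sum_congr rfl fun i _ => Finset.sum_congr rfl fun j _ => ?_
    simp
  · simp only [Finsupp.sum, Complex.im_sum, Complex.zero_im]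
    have h3 : ∀ i j, (star (x i) * (A.map (fun t => (t : ℂ))) i j * x j).im =
       ((x i).re * A i j * (x j).im) - (x j).re * A j i * (x i).im := by
      intro i j
      simp [hs j i]
      ring
    simp only [h3, Finset.sum_sub_distrib]
    rw [Finset.sum_comm, sub_self]

variable (𝕜 : Type*) [RCLike 𝕜] {V : Type*} [NormedAddCommGroup V] [InnerProductSpace 𝕜 V]

include 𝕜 in
/-- The Gaussian kernel is the product of `exp (2 Re ⟨v, w⟩)` and of a kernel of rank one. -/
theorem posSemidef_exp_neg_norm_sub_sq :
    (Matrix.of fun v w : V => Real.exp (-‖v - w‖ ^ 2)).PosSemidef := by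
  let _ : InnerProductSpace ℝ V := InnerProductSpace.rclikeToReal 𝕜 V
  have h1 := posSemidef_exp ((posSemidef_inner (fun v : V => v)).smul (a := (2 : ℝ))
    (by norm_num))
  have h2 := posSemidef_inner (fun v : V => Real.exp (-‖v‖ ^ 2))
  refine (congrArg PosSemidef ?_).mpr (h1.hadamard h2)
  ext v w
  simp only [of_apply, Matrix.smul_apply, hadamard_apply, smul_eq_mul]
  rw [show inner ℝ (Real.exp (-‖v‖ ^ 2)) (Real.exp (-‖w‖ ^ 2)) =
    Real.exp (-‖w‖ ^ 2) * Real.exp (-‖v‖ ^ 2) from rfl, ← Real.exp_add, ← Real.exp_add,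
    norm_sub_sq_real]
  congr 1
  ring

/-- The kernel `((n, v), (m, w)) ↦ exp (-‖v - w‖² / (n + 1))` for `n = m`, and zero for `n ≠ m`.
Its Hilbert space is the direct sum over `n` of the Hilbert spaces of the Gaussian kernels
of width `n + 1`. -/
def gaussKernel (V : Type*) [NormedAddCommGroup V] : Matrix (ℕ × V) (ℕ × V) ℝ :=
  Matrix.of fun a b => if a.1 = b.1 then Real.exp (-(‖a.2 - b.2‖ ^ 2 / (a.1 + 1))) else 0

include 𝕜 in
theorem posSemidef_gaussKernel : (gaussKernel V).PosSemidef := by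
  have h1 := (posSemidef_exp_neg_norm_sub_sq 𝕜 (V := V)).submatrix
    (fun a : ℕ × V => ((Real.sqrt (a.1 + 1))⁻¹ : 𝕜) • a.2)
  have h2 := (Matrix.PosSemidef.one (n := ℕ) (R := ℝ)).submatrix (Prod.fst : ℕ × V → ℕ)
  refine (congrArg PosSemidef ?_).mpr (h2.hadamard h1)
  ext a b
  simp only [gaussKernel, of_apply, hadamard_apply, submatrix_apply, one_apply]
  split_ifs with h
  · rw [h, ← smul_sub, norm_smul, mul_pow, one_mul]
    congr 2
    rw [norm_inv, RCLike.norm_ofReal, abs_of_nonneg (Real.sqrt_nonneg _), inv_pow,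
      Real.sq_sqrt (by positivity)]
    ring
  · simp

end Kernel

/-- Every positive semidefinite kernel is the Gram matrix of a total family in a Hilbert space, the
reproducing kernel Hilbert space. -/
theorem exists_hilbertSpace_of_posSemidef {ι : Type w} {k : Matrix ι ι ℂ}
    (hk : letI := Complex.partialOrder; k.PosSemidef) :
    ∃ (E : Type w) (_ : NormedAddCommGroup E) (_ : InnerProductSpace ℂ E) (_ : CompleteSpace E)
      (e : ι → E), (∀ i j, inner ℂ (e i) (e j) = k i j) ∧
        Dense (Submodule.span ℂ (Set.range e) : Set E) := by
  let _ := Complex.partialOrder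
  -- `RKHS` expects a kernel whose values are operators.
  let K : Matrix ι ι (ℂ →L[ℂ] ℂ) := k.map fun c => c • ContinuousLinearMap.id ℂ ℂ
  have hK : K.PosSemidef := by
    refine (RKHS.posSemidef_tfae.out 0 2).2 (And.intro ?_ fun vv => ?_)
    · ext i j
      have h := hk.isHermitian.apply i j
      have h1 : ContinuousLinearMap.adjoint (ContinuousLinearMap.id ℂ ℂ) =
          ContinuousLinearMap.id ℂ ℂ := star_one (R := ℂ →L[ℂ] ℂ)
      simpa [K, ContinuousLinearMap.star_eq_adjoint, h1] using h
    · have h := (Complex.le_def.1 (hk.2 vv)).1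
      refine h.trans_eq (congrArg Complex.re ?_)
      refine Finset.sum_congr rfl fun i _ => Finset.sum_congr rfl fun j _ => ?_
      simp only [K, ← hk.isHermitian.apply i j]
      simp
      ring
  have : Fact K.PosSemidef := ⟨hK⟩
  refine ⟨RKHS.OfKernel K, inferInstance, inferInstance, inferInstance,
    fun i => RKHS.kerFun (RKHS.OfKernel K) i 1, fun i j => ?_, ?_⟩
  · rw [← RKHS.kernel_inner, RKHS.OfKernel.kernel_ofKernel]
    simpa [K] using hk.isHermitian.apply i j
  · refine Dense.mono ?_ (Submodule.dense_iff_topologicalClosure_eq_top.2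
      (RKHS.kerFun_dense (RKHS.OfKernel K)))
    refine Submodule.span_le.2 ?_
    rintro _ ⟨i, z, rfl⟩
    rw [show z = z • (1 : ℂ) by simp, map_smul]
    exact Submodule.smul_mem _ _ (Submodule.subset_span ⟨i, rfl⟩)

/-! ### Circumcenters -/

section Circumcenter

variable {V : Type*} [NormedAddCommGroup V]

/-- The radius of the smallest ball with center `v` that contains the bounded set `S`. -/
def circumradius (S : Set V) (v : V) : ℝ := sSup ((fun w => ‖v - w‖) '' S)

theorem bddAbove_norm_sub_image {S : Set V} (hb : Bornology.IsBounded S) (v : V) :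
    BddAbove ((fun w => ‖v - w‖) '' S) := by
  obtain ⟨C, hC⟩ := hb.exists_norm_le
  refine ⟨‖v‖ + C, ?_⟩
  rintro _ ⟨w, hw, rfl⟩
  exact (norm_sub_le v w).trans (by gcongr; exact hC w hw)

theorem circumradius_le_iff {S : Set V} (hne : S.Nonempty) (hb : Bornology.IsBounded S) {v : V}
    {C : ℝ} : circumradius S v ≤ C ↔ ∀ w ∈ S, ‖v - w‖ ≤ C := by
  rw [circumradius, csSup_le_iff (bddAbove_norm_sub_image hb v) (hne.image _)]
  simp

theorem norm_sub_le_circumradius {S : Set V} (hb : Bornology.IsBounded S) (v : V) {w : V}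
    (hw : w ∈ S) : ‖v - w‖ ≤ circumradius S v :=
  le_csSup (bddAbove_norm_sub_image hb v) ⟨w, hw, rfl⟩

theorem circumradius_nonneg (S : Set V) (v : V) : 0 ≤ circumradius S v :=
  Real.sSup_nonneg (by rintro _ ⟨w, _, rfl⟩; exact norm_nonneg _)

theorem circumradius_le_add {S : Set V} (hne : S.Nonempty) (hb : Bornology.IsBounded S) (v w : V) :
    circumradius S v ≤ circumradius S w + ‖v - w‖ := by
  refine (circumradius_le_iff hne hb).2 fun s hs => ?_
  calc ‖v - s‖ ≤ ‖v - w‖ + ‖w - s‖ := norm_sub_le_norm_sub_add_norm_sub v w s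
    _ ≤ circumradius S w + ‖v - w‖ := by
      rw [add_comm]
      gcongr
      exact norm_sub_le_circumradius hb w hs

theorem continuous_circumradius {S : Set V} (hne : S.Nonempty) (hb : Bornology.IsBounded S) :
    Continuous (circumradius S) := by
  refine (LipschitzWith.of_le_add (f := circumradius S) fun v w => ?_).continuous
  rw [dist_eq_norm]
  exact circumradius_le_add hne hb v w

theorem circumradius_image {V' : Type*} [NormedAddCommGroup V'] {φ : V → V'}
    (hφ : ∀ a b, ‖φ a - φ b‖ = ‖a - b‖) (S : Set V) (v : V) :
    circumradius (φ '' S) (φ v) = circumradius S v := by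
  simp only [circumradius, Set.image_image, hφ]

/-- The infimum of the circumradii. -/
def minCircumradius (S : Set V) : ℝ := ⨅ v, circumradius S v

theorem minCircumradius_le (S : Set V) (v : V) : minCircumradius S ≤ circumradius S v :=
  ciInf_le ⟨0, by rintro _ ⟨w, rfl⟩; exact circumradius_nonneg S w⟩ v

theorem minCircumradius_nonneg (S : Set V) : 0 ≤ minCircumradius S :=
  le_ciInf fun v => circumradius_nonneg S v

theorem minCircumradius_eq_of_denseRange {S : Set V} (hne : S.Nonempty)
    (hb : Bornology.IsBounded S) {d : ℕ → V} (hd : DenseRange d) :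
    minCircumradius S = ⨅ i, circumradius S (d i) := by
  have hbdd : BddBelow (Set.range fun i => circumradius S (d i)) :=
    ⟨0, by rintro _ ⟨w, rfl⟩; exact circumradius_nonneg S _⟩
  refine le_antisymm (le_ciInf fun i => minCircumradius_le S (d i)) (le_ciInf fun v => ?_)
  refine hd.induction_on (p := fun v => ⨅ i, circumradius S (d i) ≤ circumradius S v) v
    (isClosed_le continuous_const (continuous_circumradius hne hb)) fun i => ciInf_le hbdd i

variable (𝕜 : Type*) [RCLike 𝕜] [InnerProductSpace 𝕜 V]

include 𝕜 in
/-- Quantitative uniqueness of the circumcenter, from the parallelogram law at the midpoint. -/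
theorem norm_sub_sq_le_circumradius {S : Set V} (hne : S.Nonempty) (hb : Bornology.IsBounded S)
    (v w : V) : ‖v - w‖ ^ 2 ≤
      2 * (circumradius S v ^ 2 + circumradius S w ^ 2) - 4 * minCircumradius S ^ 2 := by
  set D := (2 * (circumradius S v ^ 2 + circumradius S w ^ 2) - ‖v - w‖ ^ 2) / 4 with hD
  have h1 : ∀ s ∈ S, ‖(2⁻¹ : 𝕜) • (v + w) - s‖ ^ 2 ≤ D := by
    intro s hs
    have hp := parallelogram_law_with_norm 𝕜 (v - s) (w - s)
    have e1 : v - s + (w - s) = (2 : 𝕜) • ((2⁻¹ : 𝕜) • (v + w) - s) := by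
      rw [smul_sub, smul_smul, mul_inv_cancel₀ two_ne_zero, one_smul, two_smul]
      abel
    have e2 : v - s - (w - s) = v - w := by abel
    rw [e1, e2, norm_smul, RCLike.norm_ofNat] at hp
    have hv := pow_le_pow_left₀ (norm_nonneg _) (norm_sub_le_circumradius hb v hs) 2
    have hw := pow_le_pow_left₀ (norm_nonneg _) (norm_sub_le_circumradius hb w hs) 2
    rw [hD]
    nlinarith
  have h2 : minCircumradius S ≤ √D :=
    (minCircumradius_le S _).trans ((circumradius_le_iff hne hb).2 fun s hs =>
      Real.le_sqrt_of_sq_le (h1 s hs))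
  obtain ⟨s, hs⟩ := hne
  have h3 : minCircumradius S ^ 2 ≤ D := by
    have := pow_le_pow_left₀ (minCircumradius_nonneg S) h2 2
    rwa [Real.sq_sqrt ((sq_nonneg _).trans (h1 s hs))] at this
  rw [hD] at h3
  linarith

/-- The circumcenter of a set: the point whose circumradius is minimal. In a Hilbert space, it
exists and is unique for nonempty bounded sets; otherwise the value may be meaningless. -/
def circumcenter (S : Set V) : V :=
  Classical.epsilon fun c => circumradius S c = minCircumradius S

variable [CompleteSpace V]

include 𝕜 in
theorem circumradius_circumcenter {S : Set V} (hne : S.Nonempty) (hb : Bornology.IsBounded S) :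
    circumradius S (circumcenter S) = minCircumradius S := by
  refine Classical.epsilon_spec (p := fun c => circumradius S c = minCircumradius S) ?_
  set r := minCircumradius S with hr
  have h1 : ∀ n : ℕ, ∃ v, circumradius S v < r + 1 / (n + 1) := fun n =>
    exists_lt_of_ciInf_lt (f := circumradius S) (lt_add_of_pos_right _ Nat.one_div_pos_of_nat)
  choose d hd using h1
  have hlim : Tendsto (fun n => circumradius S (d n)) atTop (𝓝 r) := by
    refine tendsto_of_tendsto_of_tendsto_of_le_of_le tendsto_const_nhds ?_
      (fun n => minCircumradius_le S (d n)) (fun n => (hd n).le)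
    simpa using tendsto_const_nhds.add (tendsto_one_div_add_atTop_nhds_zero_nat (𝕜 := ℝ))
  -- Minimizing sequences are Cauchy.
  have hc : CauchySeq d := by
    rw [Metric.cauchySeq_iff']
    intro ε hε
    have h2 : Tendsto (fun n => circumradius S (d n) ^ 2) atTop (𝓝 (r ^ 2)) := hlim.pow 2
    obtain ⟨N, hN⟩ := eventually_atTop.1 (h2.eventually (gt_mem_nhds
      (show r ^ 2 < r ^ 2 + ε ^ 2 / 4 by have := pow_pos hε 2; linarith)))
    refine ⟨N, fun n hn => ?_⟩
    have h3 := norm_sub_sq_le_circumradius 𝕜 hne hb (d n) (d N)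
    have h4 := hN n hn
    have h5 := hN N le_rfl
    rw [dist_eq_norm]
    refine lt_of_pow_lt_pow_left₀ 2 hε.le ?_
    rw [← hr] at h3
    linarith
  obtain ⟨c, hc⟩ := cauchySeq_tendsto_of_complete hc
  exact ⟨c, tendsto_nhds_unique (((continuous_circumradius hne hb).tendsto c).comp hc) hlim⟩

include 𝕜 in
theorem eq_circumcenter {S : Set V} (hne : S.Nonempty) (hb : Bornology.IsBounded S) {c : V}
    (hc : circumradius S c = minCircumradius S) : c = circumcenter S := by
  have h := norm_sub_sq_le_circumradius 𝕜 hne hb c (circumcenter S)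
  rw [hc, circumradius_circumcenter 𝕜 hne hb] at h
  have h2 : ‖c - circumcenter S‖ ^ 2 ≤ 0 := by linarith
  rw [← sub_eq_zero, ← norm_eq_zero]
  exact pow_eq_zero_iff two_ne_zero |>.1 (le_antisymm h2 (sq_nonneg _))

include 𝕜 in
theorem tendsto_circumcenter {S : Set V} (hne : S.Nonempty) (hb : Bornology.IsBounded S)
    {d : ℕ → V} (hd : Tendsto (fun n => circumradius S (d n)) atTop (𝓝 (minCircumradius S))) :
    Tendsto d atTop (𝓝 (circumcenter S)) := by
  rw [tendsto_iff_norm_sub_tendsto_zero]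
  have h1 : Tendsto (fun n => ‖d n - circumcenter S‖ ^ 2) atTop (𝓝 0) := by
    refine squeeze_zero (fun n => sq_nonneg _)
      (fun n => norm_sub_sq_le_circumradius 𝕜 hne hb (d n) (circumcenter S)) ?_
    rw [circumradius_circumcenter 𝕜 hne hb]
    have := (((hd.pow 2).add_const (minCircumradius S ^ 2)).const_mul 2).sub_const
      (4 * minCircumradius S ^ 2)
    convert this using 2
    ring
  have h2 := h1.sqrt
  simpa [Real.sqrt_sq (norm_nonneg _)] using h2

include 𝕜 in
theorem circumcenter_image {V' : Type*} [NormedAddCommGroup V'] [InnerProductSpace 𝕜 V']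
    [CompleteSpace V'] {φ : V → V'} (hφ : ∀ a b, ‖φ a - φ b‖ = ‖a - b‖)
    (hsurj : Function.Surjective φ) {S : Set V} (hne : S.Nonempty) (hb : Bornology.IsBounded S) :
    φ (circumcenter S) = circumcenter (φ '' S) := by
  have hb' : Bornology.IsBounded (φ '' S) := by
    obtain ⟨s, hs⟩ := hne
    obtain ⟨C, hC⟩ := hb.exists_norm_le
    refine (isBounded_iff_forall_norm_le).2 ⟨(C + ‖s‖) + ‖φ s‖, ?_⟩
    rintro _ ⟨t, ht, rfl⟩
    calc ‖φ t‖ = ‖(φ t - φ s) + φ s‖ := by rw [sub_add_cancel]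
      _ ≤ ‖φ t - φ s‖ + ‖φ s‖ := norm_add_le _ _
      _ ≤ (C + ‖s‖) + ‖φ s‖ := by
        rw [hφ]
        gcongr
        exact (norm_sub_le t s).trans (by gcongr; exact hC t ht)
  refine eq_circumcenter 𝕜 (hne.image φ) hb' ?_
  rw [circumradius_image hφ, circumradius_circumcenter 𝕜 hne hb, minCircumradius, minCircumradius,
    ← hsurj.iInf_comp]
  simp only [circumradius_image hφ]

end Circumcenter

/-! ### The Hilbert space of the Gaussian kernels -/

section Gauss

variable {V : Type*} [NormedAddCommGroup V] {E : Type*} [NormedAddCommGroup E]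
  [InnerProductSpace ℂ E] {e : ℕ × V → E}

theorem gaussKernel_self (a : ℕ × V) : gaussKernel V a a = 1 := by simp [gaussKernel]

theorem norm_gaussVec (he : ∀ a b, inner ℂ (e a) (e b) = gaussKernel V a b) (a : ℕ × V) :
    ‖e a‖ = 1 := by
  have h := inner_self_eq_norm_sq (𝕜 := ℂ) (e a)
  rw [he, gaussKernel_self] at h
  exact (pow_eq_one_iff_of_nonneg (norm_nonneg _) two_ne_zero).1 (by simpa using h.symm)

theorem norm_gaussVec_sub_sq (he : ∀ a b, inner ℂ (e a) (e b) = gaussKernel V a b)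
    (a b : ℕ × V) : ‖e a - e b‖ ^ 2 = 2 - 2 * gaussKernel V a b := by
  rw [norm_sub_sq (𝕜 := ℂ), he, norm_gaussVec he, norm_gaussVec he]
  simp
  ring

theorem continuous_gaussVec (he : ∀ a b, inner ℂ (e a) (e b) = gaussKernel V a b) (n : ℕ) :
    Continuous fun v => e (n, v) := by
  rw [continuous_iff_continuousAt]
  intro v
  rw [ContinuousAt, tendsto_iff_norm_sub_tendsto_zero]
  have h1 : Continuous fun w : V => 2 - 2 * gaussKernel V (n, w) (n, v) := by
    simp only [gaussKernel, Matrix.of_apply, if_true]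
    fun_prop
  have h2 := (h1.tendsto v).sqrt
  simp only [gaussKernel_self, ← norm_gaussVec_sub_sq he, Real.sqrt_sq (norm_nonneg _)] at h2
  simpa using h2

/-- A vector in the Hilbert space of the Gaussian kernels, viewed as a function on `ℕ × V`,
vanishes at infinity of `V`, uniformly in the first variable. -/
theorem tendsto_inner_gaussVec (he : ∀ a b, inner ℂ (e a) (e b) = gaussKernel V a b)
    (hd : Dense (Submodule.span ℂ (Set.range e) : Set E)) (η : E) :
    Tendsto (fun a => inner ℂ (e a) η) ((Bornology.cobounded V).comap Prod.snd) (𝓝 0) := by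
  have hspan : ∀ ζ ∈ Submodule.span ℂ (Set.range e),
      Tendsto (fun a => inner ℂ (e a) ζ) ((Bornology.cobounded V).comap Prod.snd) (𝓝 0) := by
    intro ζ hζ
    induction hζ using Submodule.span_induction with
    | mem ζ h =>
      obtain ⟨b, rfl⟩ := h
      have h1 : Tendsto (fun a : ℕ × V => ‖a.2 - b.2‖)
          ((Bornology.cobounded V).comap Prod.snd) atTop := by
        refine tendsto_atTop_mono (f := fun a : ℕ × V => ‖a.2‖ + -‖b.2‖) (fun a => ?_) ?_
        · have := norm_sub_norm_le a.2 b.2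
          linarith
        · exact tendsto_atTop_add_const_right _ _ (tendsto_norm_cobounded_atTop.comp tendsto_comap)
      have h2 : Tendsto (fun a : ℕ × V => Real.exp (-(‖a.2 - b.2‖ ^ 2 / (b.1 + 1))))
          ((Bornology.cobounded V).comap Prod.snd) (𝓝 0) := by
        refine Real.tendsto_exp_neg_atTop_nhds_zero.comp ?_
        exact ((tendsto_pow_atTop two_ne_zero).comp h1).atTop_div_const (by positivity)
      refine squeeze_zero_norm (fun a => ?_) h2
      rw [he]
      simp only [gaussKernel, Matrix.of_apply]
      split_ifs with h
      · rw [h, Complex.norm_real, Real.norm_of_nonneg (Real.exp_pos _).le]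
      · simp [Real.exp_nonneg]
    | zero => simpa only [inner_zero_right] using tendsto_const_nhds
    | add x y _ _ hx hy => simpa only [inner_add_right, add_zero] using hx.add hy
    | smul c x _ hx => simpa only [inner_smul_right, mul_zero] using hx.const_mul c
  rw [Metric.tendsto_nhds]
  intro ε hε
  obtain ⟨ζ, hζ, hζε⟩ := Metric.dense_iff.1 hd η (ε / 2) (by positivity)
  filter_upwards [Metric.tendsto_nhds.1 (hspan ζ hζε) (ε / 2) (by positivity)] with a ha
  rw [dist_zero_right] at ha ⊢
  have h1 : inner ℂ (e a) η = inner ℂ (e a) ζ + inner ℂ (e a) (η - ζ) := by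
    rw [← inner_add_right]
    congr 1
    abel
  have h2 : ‖inner ℂ (e a) (η - ζ)‖ ≤ ‖η - ζ‖ := by
    simpa only [norm_gaussVec he, one_mul] using norm_inner_le_norm (𝕜 := ℂ) (e a) (η - ζ)
  rw [Metric.mem_ball, dist_comm, dist_eq_norm] at hζ
  rw [h1]
  refine (norm_add_le _ _).trans_lt ?_
  linarith

/-- The points of `V` at which the function of `η` on `ℕ × V` has an absolute value greater than
`1 / (k + 1)`. -/
def superlevel (e : ℕ × V → E) (η : E) (k : ℕ) : Set V :=
  {v | ∃ n, 1 / ((k : ℝ) + 1) < ‖inner ℂ (e (n, v)) η‖}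

theorem isBounded_superlevel (he : ∀ a b, inner ℂ (e a) (e b) = gaussKernel V a b)
    (hd : Dense (Submodule.span ℂ (Set.range e) : Set E)) (η : E) (k : ℕ) :
    Bornology.IsBounded (superlevel e η k) := by
  have h := Metric.tendsto_nhds.1 (tendsto_inner_gaussVec he hd η) (1 / ((k : ℝ) + 1))
    Nat.one_div_pos_of_nat
  rw [eventually_comap] at h
  rw [← Bornology.isCobounded_compl_iff]
  refine mem_of_superset h fun v hv => ?_
  rintro ⟨n, hn⟩
  have := hv (n, v) rfl
  rw [dist_zero_right] at this
  exact lt_asymm hn this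

theorem isOpen_superlevel (he : ∀ a b, inner ℂ (e a) (e b) = gaussKernel V a b) (η : E) (k : ℕ) :
    IsOpen (superlevel e η k) := by
  have : superlevel e η k = ⋃ n, {v | 1 / ((k : ℝ) + 1) < ‖inner ℂ (e (n, v)) η‖} := by
    ext v
    simp [superlevel]
  rw [this]
  refine isOpen_iUnion fun n => isOpen_lt continuous_const ?_
  exact ((continuous_gaussVec he n).inner continuous_const).norm

omit [NormedAddCommGroup V] in
theorem exists_superlevel_nonempty (hd : Dense (Submodule.span ℂ (Set.range e) : Set E)) {η : E}
    (hη : η ≠ 0) : ∃ k, (superlevel e η k).Nonempty := by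
  by_contra! hcon
  have h0 : ∀ a, inner ℂ (e a) η = 0 := by
    rintro ⟨n, v⟩
    by_contra hne
    obtain ⟨k, hk⟩ := exists_nat_one_div_lt (norm_pos_iff.2 hne)
    exact (Set.ext_iff.1 (hcon k) v).1 ⟨n, hk⟩
  refine hη (hd.eq_zero_of_inner_right ℂ fun ζ hζ => ?_)
  refine Submodule.span_induction (p := fun z _ => inner ℂ z η = 0) ?_ (by simp) ?_ ?_ hζ
  · rintro _ ⟨a, rfl⟩
    exact h0 a
  · intro x y _ _ hx hy
    rw [inner_add_left, hx, hy, add_zero]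
  · intro c x _ hx
    rw [inner_smul_left, hx, mul_zero]

end Gauss

section Superlevel

variable {V V' E E' : Type*} [NormedAddCommGroup E] [InnerProductSpace ℂ E]
  [NormedAddCommGroup E'] [InnerProductSpace ℂ E']

/-- The first of the superlevel sets of `η` that is not empty, and the empty set if there is
none. -/
def firstSuperlevel (e : ℕ × V → E) (η : E) : Set V :=
  {v | ∃ k, v ∈ superlevel e η k ∧ ∀ k' < k, superlevel e η k' = ∅}

theorem exists_firstSuperlevel_eq {e : ℕ × V → E} {η : E}
    (h : ∃ k, (superlevel e η k).Nonempty) :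
    ∃ k, firstSuperlevel e η = superlevel e η k ∧ (superlevel e η k).Nonempty := by
  classical
  refine ⟨Nat.find h, ?_, Nat.find_spec h⟩
  have h1 : ∀ k' < Nat.find h, superlevel e η k' = ∅ := fun k' hk' =>
    Set.not_nonempty_iff_eq_empty.1 (Nat.find_min h hk')
  ext v
  refine ⟨?_, fun hv => ⟨_, hv, h1⟩⟩
  rintro ⟨k, hv, hk⟩
  have h2 : k = Nat.find h := by
    refine le_antisymm (not_lt.1 fun hlt => ?_) (Nat.find_min' h ⟨v, hv⟩)
    exact (Nat.find_spec h).ne_empty (hk _ hlt)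
  rwa [← h2]

theorem superlevel_image {e : ℕ × V → E} {e' : ℕ × V' → E'} {φ : V → V'}
    (hφ : Function.Surjective φ) {Φ : E ≃ₗᵢ[ℂ] E'} (hΦ : ∀ a, Φ (e a) = e' (a.1, φ a.2)) (η : E)
    (k : ℕ) : superlevel e' (Φ η) k = φ '' superlevel e η k := by
  have h : ∀ n v, inner ℂ (e' (n, φ v)) (Φ η) = inner ℂ (e (n, v)) η := by
    intro n v
    rw [← hΦ (n, v), Φ.inner_map_map]
  ext w
  constructor
  · obtain ⟨v, rfl⟩ := hφ w
    rintro ⟨n, hn⟩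
    exact ⟨v, ⟨n, by rwa [← h]⟩, rfl⟩
  · rintro ⟨v, ⟨n, hn⟩, rfl⟩
    exact ⟨n, by rwa [h]⟩

theorem firstSuperlevel_image {e : ℕ × V → E} {e' : ℕ × V' → E'} {φ : V → V'}
    (hφ : Function.Surjective φ) {Φ : E ≃ₗᵢ[ℂ] E'} (hΦ : ∀ a, Φ (e a) = e' (a.1, φ a.2))
    (η : E) : firstSuperlevel e' (Φ η) = φ '' firstSuperlevel e η := by
  ext w
  simp only [firstSuperlevel, superlevel_image hφ hΦ, Set.image_eq_empty, Set.mem_image,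
    Set.mem_ofPred_eq]
  constructor
  · rintro ⟨k, ⟨v, hv, rfl⟩, hk⟩
    exact ⟨v, ⟨k, hv, hk⟩, rfl⟩
  · rintro ⟨v, ⟨k, hv, hk⟩, rfl⟩
    exact ⟨k, ⟨v, hv, rfl⟩, hk⟩

end Superlevel

namespace MeasuredGroupoid

/-! ### Borel sections of Hilbert bundles -/

namespace HilbertBundle

variable {𝕜 : Type k} [RCLike 𝕜] {X : Type u} [MeasurableSpace X] {H : HilbertBundle.{k, w} 𝕜 X}

theorem dense_span_fund (x : X) :
    Dense (Submodule.span 𝕜 (Set.range fun n => H.fund n x) : Set (H.Fiber x)) := by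
  rw [Submodule.dense_iff_topologicalClosure_eq_top, Submodule.topologicalClosure_eq_top_iff,
    Submodule.eq_bot_iff]
  intro v hv
  refine H.separating x v 0 fun n => ?_
  rw [inner_zero_right]
  exact (Submodule.mem_orthogonal _ v).1 hv _ (Submodule.subset_span ⟨n, rfl⟩)

variable (H) in
/-- A sequence of Borel sections that is dense in every fibre: the linear combinations of the
fundamental sequence with coefficients in a countable dense set of scalars. -/
def denseSec (i : ℕ) (x : X) : H.Fiber x :=
  ratComb 𝕜 (fun n => H.fund n x) (Denumerable.ofNat (List (ℕ × ℕ)) i)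

theorem denseRange_denseSec (x : X) : DenseRange fun i => H.denseSec i x := by
  have h := denseRange_ratComb (dense_span_fund (H := H) x)
  have h2 : Function.Surjective (Denumerable.ofNat (List (ℕ × ℕ))) :=
    (Denumerable.eqv (List (ℕ × ℕ))).symm.surjective
  rw [DenseRange, ← h2.range_comp] at h
  exact h

theorem denseSec_zero (x : X) : H.denseSec 0 x = 0 := by
  simp [denseSec]

/-- The squared norm as a countable supremum of functions that are Borel by the definition of a
Hilbert bundle: the terms are `‖v‖² - ‖dᵢ - v‖²` for a dense sequence `dᵢ`. -/
theorem norm_sq_eq_iSup (x : X) (v : H.Fiber x) :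
    ‖v‖ ^ 2 = ⨆ i, (2 * RCLike.re (inner 𝕜 (H.denseSec i x) v) -
      RCLike.re (inner 𝕜 (H.denseSec i x) (H.denseSec i x))) := by
  have h : ∀ i, 2 * RCLike.re (inner 𝕜 (H.denseSec i x) v) -
      RCLike.re (inner 𝕜 (H.denseSec i x) (H.denseSec i x)) =
      ‖v‖ ^ 2 - ‖H.denseSec i x - v‖ ^ 2 := by
    intro i
    rw [norm_sub_sq (𝕜 := 𝕜), inner_self_eq_norm_sq]
    ring
  simp only [h]
  refine le_antisymm ?_ (ciSup_le fun i => sub_le_self _ (sq_nonneg _))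
  have hbdd : BddAbove (Set.range fun i => ‖v‖ ^ 2 - ‖H.denseSec i x - v‖ ^ 2) :=
    ⟨‖v‖ ^ 2, by rintro _ ⟨i, rfl⟩; exact sub_le_self _ (sq_nonneg _)⟩
  have h2 := (denseRange_denseSec (H := H) x).induction_on
    (p := fun w => ‖v‖ ^ 2 - ‖w - v‖ ^ 2 ≤ ⨆ i, (‖v‖ ^ 2 - ‖H.denseSec i x - v‖ ^ 2)) v
    (isClosed_le (by fun_prop) continuous_const) fun i => le_ciSup hbdd i
  simpa using h2

section Pullback

variable [StandardBorelSpace X] {Y : Type*} [MeasurableSpace Y] {p : Y → X}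
  {f g : ∀ y, H.Fiber (p y)}

theorem IsPullbackSection.measurable_inner_fund (hf : H.IsPullbackSection p f) (n : ℕ) :
    Measurable fun y => inner 𝕜 (H.fund n (p y)) (f y) :=
  (isPullbackSection_iff.1 hf).2 n

theorem isPullbackSection_fund (hp : Measurable p) (n : ℕ) :
    H.IsPullbackSection p fun y => H.fund n (p y) :=
  isPullbackSection_iff.2 ⟨hp, fun m => (H.measurable_gram m n).comp hp⟩

theorem isPullbackSection_zero (hp : Measurable p) : H.IsPullbackSection p fun _ => 0 :=
  isPullbackSection_iff.2 ⟨hp, fun m => by simp⟩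

theorem IsPullbackSection.add (hf : H.IsPullbackSection p f) (hg : H.IsPullbackSection p g) :
    H.IsPullbackSection p fun y => f y + g y := by
  rw [isPullbackSection_iff] at hf hg ⊢
  refine ⟨hf.1, fun n => ?_⟩
  simpa only [inner_add_right] using (hf.2 n).fun_add (hg.2 n)

theorem IsPullbackSection.sub (hf : H.IsPullbackSection p f) (hg : H.IsPullbackSection p g) :
    H.IsPullbackSection p fun y => f y - g y := by
  rw [isPullbackSection_iff] at hf hg ⊢
  refine ⟨hf.1, fun n => ?_⟩
  simpa only [inner_sub_right] using (hf.2 n).fun_sub (hg.2 n)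

theorem IsPullbackSection.const_smul (hf : H.IsPullbackSection p f) (c : 𝕜) :
    H.IsPullbackSection p fun y => c • f y := by
  rw [isPullbackSection_iff] at hf ⊢
  refine ⟨hf.1, fun n => ?_⟩
  simpa only [inner_smul_right] using (hf.2 n).const_mul c

theorem isPullbackSection_denseSec (hp : Measurable p) (i : ℕ) :
    H.IsPullbackSection p fun y => H.denseSec i (p y) := by
  unfold denseSec
  induction Denumerable.ofNat (List (ℕ × ℕ)) i with
  | nil => simpa using isPullbackSection_zero hp
  | cons a l ih =>
    simp only [ratComb_cons]
    exact ((isPullbackSection_fund hp _).const_smul _).add ih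

theorem IsPullbackSection.measurable_inner_denseSec (hf : H.IsPullbackSection p f) (i : ℕ) :
    Measurable fun y => inner 𝕜 (H.denseSec i (p y)) (f y) := by
  unfold denseSec
  induction Denumerable.ofNat (List (ℕ × ℕ)) i with
  | nil => simp
  | cons a l ih =>
    simp only [ratComb_cons, inner_add_left, inner_smul_left]
    exact ((hf.measurable_inner_fund _).const_mul _).add ih

theorem IsPullbackSection.measurable_norm (hf : H.IsPullbackSection p f) :
    Measurable fun y => ‖f y‖ := by
  have hp := (isPullbackSection_iff.1 hf).1
  have h : Measurable fun y => ‖f y‖ ^ 2 := by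
    simp only [norm_sq_eq_iSup]
    refine Measurable.iSup fun i => ?_
    have h1 := RCLike.measurable_re.comp (hf.measurable_inner_denseSec i)
    have h2 := RCLike.measurable_re.comp
      ((isPullbackSection_denseSec (H := H) hp i).measurable_inner_denseSec i)
    exact (h1.const_mul 2).sub h2
  simpa [Real.sqrt_sq (norm_nonneg _)] using h.sqrt

theorem isPullbackSection_of_tendsto {F : ℕ → ∀ y, H.Fiber (p y)}
    (hF : ∀ i, H.IsPullbackSection p (F i))
    (hlim : ∀ y, Tendsto (fun i => F i y) atTop (𝓝 (f y))) : H.IsPullbackSection p f := by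
  refine isPullbackSection_iff.2 ⟨(isPullbackSection_iff.1 (hF 0)).1, fun n => ?_⟩
  refine measurable_of_tendsto_metrizable (fun i => (hF i).measurable_inner_fund n)
    (tendsto_pi_nhds.2 fun y => ?_)
  exact tendsto_const_nhds.inner (hlim y)

/-- Borel selections from a sequence of Borel sections are Borel. -/
theorem isPullbackSection_select {F : ℕ → ∀ y, H.Fiber (p y)}
    (hF : ∀ i, H.IsPullbackSection p (F i)) {j : Y → ℕ} (hj : Measurable j) :
    H.IsPullbackSection p fun y => F (j y) y := by
  refine isPullbackSection_iff.2 ⟨(isPullbackSection_iff.1 (hF 0)).1, fun n => ?_⟩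
  have : Measurable fun q : Y × ℕ => inner 𝕜 (H.fund n (p q.1)) (F q.2 q.1) :=
    measurable_from_prod_countable_left fun i => (hF i).measurable_inner_fund n
  exact this.comp (measurable_id.prodMk hj)

end Pullback

/-- Every Borel section is a pointwise limit of Borel selections from the dense sequence. -/
theorem IsSection.exists_approx [StandardBorelSpace X] {ξ : ∀ x, H.Fiber x} (hξ : H.IsSection ξ) :
    ∃ j : ℕ → X → ℕ, (∀ m, Measurable (j m)) ∧
      ∀ x, Tendsto (fun m => H.denseSec (j m x) x) atTop (𝓝 (ξ x)) := by
  classical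
  have hex : ∀ (m : ℕ) (x : X), ∃ i, ‖H.denseSec i x - ξ x‖ < 1 / ((m : ℝ) + 1) := by
    intro m x
    obtain ⟨i, hi⟩ := (denseRange_denseSec (H := H) x).exists_dist_lt (ξ x)
      (Nat.one_div_pos_of_nat (n := m) (α := ℝ))
    exact ⟨i, by rwa [dist_comm, dist_eq_norm] at hi⟩
  refine ⟨fun m x => Nat.find (hex m x), fun m => ?_, fun x => ?_⟩
  · refine measurable_find _ fun i => ?_
    have h1 := ((isPullbackSection_denseSec (H := H) measurable_id i).sub
      (show H.IsPullbackSection (fun x => x) ξ from hξ)).measurable_norm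
    exact measurableSet_lt h1 measurable_const
  · rw [tendsto_iff_norm_sub_tendsto_zero]
    exact squeeze_zero (fun m => norm_nonneg _) (fun m => (Nat.find_spec (hex m x)).le)
      tendsto_one_div_add_atTop_nhds_zero_nat

/-- The circumcenters of a Borel family of nonempty bounded open sets form a Borel section. As the
sets are open, it is enough to know which members of the dense sequence they contain. -/
theorem isSection_circumcenter [StandardBorelSpace X] {S : ∀ x, Set (H.Fiber x)}
    (hne : ∀ x, (S x).Nonempty) (hb : ∀ x, Bornology.IsBounded (S x)) (ho : ∀ x, IsOpen (S x))
    (hm : ∀ i, MeasurableSet {x | H.denseSec i x ∈ S x}) :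
    H.IsSection fun x => circumcenter (S x) := by
  classical
  -- An open set is contained in the closure of its points in the dense sequence, so that countably
  -- many inequalities say that a circumradius is at most `C`.
  have hmR : ∀ i, Measurable fun x => circumradius (S x) (H.denseSec i x) := by
    intro i
    refine measurable_of_Iic fun C => ?_
    have h : (fun x => circumradius (S x) (H.denseSec i x)) ⁻¹' Set.Iic C =
        ⋂ j, ({x | H.denseSec j x ∈ S x}ᶜ ∪ {x | ‖H.denseSec i x - H.denseSec j x‖ ≤ C}) := by
      ext x
      simp only [Set.mem_preimage, Set.mem_Iic, circumradius_le_iff (hne x) (hb x), Set.mem_iInter,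
        Set.mem_union, Set.mem_compl_iff, Set.mem_ofPred_eq, ← imp_iff_not_or]
      refine ⟨fun h j hj => h _ hj, fun h v hv => ?_⟩
      have hcl := (denseRange_denseSec (H := H) x).open_subset_closure_inter (ho x) hv
      refine closure_minimal (t := {v | ‖H.denseSec i x - v‖ ≤ C}) ?_
        (isClosed_le (by fun_prop) continuous_const) hcl
      rintro _ ⟨hj, j, rfl⟩
      exact h j hj
    rw [h]
    refine MeasurableSet.iInter fun j => (hm j).compl.union ?_
    exact measurableSet_le ((isPullbackSection_denseSec (H := H) measurable_id i).sub
      (isPullbackSection_denseSec measurable_id j)).measurable_norm measurable_const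
  have hmr : Measurable fun x => minCircumradius (S x) := by
    have h : (fun x => minCircumradius (S x)) =
        fun x => ⨅ i, circumradius (S x) (H.denseSec i x) := by
      funext x
      exact minCircumradius_eq_of_denseRange (hne x) (hb x) (denseRange_denseSec x)
    rw [h]
    exact Measurable.iInf hmR
  have hex : ∀ (m : ℕ) (x : X), ∃ i,
      circumradius (S x) (H.denseSec i x) < minCircumradius (S x) + 1 / ((m : ℝ) + 1) := by
    intro m x
    rw [minCircumradius_eq_of_denseRange (hne x) (hb x) (denseRange_denseSec x)]
    exact exists_lt_of_ciInf_lt (lt_add_of_pos_right _ Nat.one_div_pos_of_nat)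
  -- The circumcenter is the limit of almost minimal members of the dense sequence.
  refine isPullbackSection_of_tendsto (p := fun x => x)
    (F := fun m x => H.denseSec (Nat.find (hex m x)) x) (fun m => ?_) fun x => ?_
  · refine isPullbackSection_select (F := fun i x => H.denseSec i x)
      (fun i => isPullbackSection_denseSec measurable_id i) ?_
    exact measurable_find _ fun i => measurableSet_lt (hmR i) (hmr.add measurable_const)
  · refine tendsto_circumcenter 𝕜 (hne x) (hb x) ?_
    refine tendsto_of_tendsto_of_tendsto_of_le_of_le tendsto_const_nhds ?_
      (fun m => minCircumradius_le _ _) (fun m => (Nat.find_spec (hex m x)).le)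
    simpa using tendsto_const_nhds.add (tendsto_one_div_add_atTop_nhds_zero_nat (𝕜 := ℝ))

end HilbertBundle

end MeasuredGroupoid

/-! ### Hilbert bundles with a given Gram matrix -/

/-- A Borel embedding with values in a standard Borel space has a standard Borel domain. -/
theorem standardBorelSpace_of_measurableEmbedding {α β : Type*} [MeasurableSpace β]
    [StandardBorelSpace β] {j : α → β} (hj : Function.Injective j)
    (hr : MeasurableSet (Set.range j)) :
    @StandardBorelSpace α (MeasurableSpace.comap j inferInstance) := by
  let _ : MeasurableSpace α := MeasurableSpace.comap j inferInstance
  obtain ⟨τ, hb, hp, hc, -⟩ := hr.isClopenable'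
  let t : TopologicalSpace α := TopologicalSpace.induced j τ
  have hemb : IsClosedEmbedding j := ⟨⟨⟨rfl⟩, hj⟩, hc⟩
  have : PolishSpace α := hemb.polishSpace
  exact ⟨t, ⟨(congrArg (MeasurableSpace.comap j) hb.measurable_eq).trans borel_comap.symm⟩, this⟩

theorem exists_linearIsometryEquiv_of_gram_eq {ι E E' : Type*} [NormedAddCommGroup E]
    [InnerProductSpace ℂ E] [CompleteSpace E] [NormedAddCommGroup E'] [InnerProductSpace ℂ E']
    [CompleteSpace E'] {e : ι → E} {e' : ι → E'}
    (h : ∀ i j, inner ℂ (e i) (e j) = inner ℂ (e' i) (e' j))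
    (hd : Dense (Submodule.span ℂ (Set.range e) : Set E))
    (hd' : Dense (Submodule.span ℂ (Set.range e') : Set E')) :
    ∃ Φ : E ≃ₗᵢ[ℂ] E', ∀ i, Φ (e i) = e' i := by
  have h1 : DenseRange (Finsupp.linearCombination ℂ e) := by
    rwa [DenseRange, ← LinearMap.coe_range, Finsupp.range_linearCombination]
  have h2 : DenseRange (Finsupp.linearCombination ℂ e') := by
    rwa [DenseRange, ← LinearMap.coe_range, Finsupp.range_linearCombination]
  have h3 : ∀ c : ι →₀ ℂ, ‖Finsupp.linearCombination ℂ e' (LinearEquiv.refl ℂ _ c)‖ =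
      ‖Finsupp.linearCombination ℂ e c‖ := by
    intro c
    have h4 : inner ℂ (Finsupp.linearCombination ℂ e' c) (Finsupp.linearCombination ℂ e' c) =
        inner ℂ (Finsupp.linearCombination ℂ e c) (Finsupp.linearCombination ℂ e c) := by
      simp only [Finsupp.linearCombination_apply, Finsupp.sum, sum_inner, inner_sum,
        inner_smul_left, inner_smul_right, h]
    rw [LinearEquiv.refl_apply, @norm_eq_sqrt_re_inner ℂ, @norm_eq_sqrt_re_inner ℂ E, h4]
  refine ⟨(LinearEquiv.refl ℂ (ι →₀ ℂ)).extendOfIsometry _ _ h1 h2 h3, fun i => ?_⟩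
  have h5 := LinearEquiv.extendOfIsometry_eq (LinearEquiv.refl ℂ (ι →₀ ℂ)) _ _ h1 h2 h3
    (Finsupp.single i 1)
  simpa using h5

/-- Riesz representation in terms of a total sequence: the sequences `n ↦ ⟨e n, v⟩` are those that
define a bounded functional on the rational combinations of the vectors `e n`. -/
theorem exists_forall_inner_eq_iff {F : Type*} [NormedAddCommGroup F] [InnerProductSpace ℂ F]
    [CompleteSpace F] {e : ℕ → F} (hd : Dense (Submodule.span ℂ (Set.range e) : Set F))
    (f : ℕ → ℂ) : (∃ v, ∀ n, inner ℂ (e n) v = f n) ↔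
      ∃ M : ℕ, ∀ l, ‖ratComb ℂ (fun n => starRingEnd ℂ (f n)) l‖ ≤ M * ‖ratComb ℂ e l‖ := by
  constructor
  · rintro ⟨v, hv⟩
    obtain ⟨M, hM⟩ := exists_nat_ge ‖v‖
    refine ⟨M, fun l => ?_⟩
    have h1 : ratComb ℂ (fun n => starRingEnd ℂ (f n)) l = inner ℂ v (ratComb ℂ e l) := by
      have := map_ratComb (innerSL ℂ v).toLinearMap e l
      simp only [ContinuousLinearMap.coe_coe, innerSL_apply_apply] at this
      rw [this]
      congr 1
      funext n
      rw [← hv, inner_conj_symm]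
    rw [h1]
    exact (norm_inner_le_norm _ _).trans (by gcongr)
  · rintro ⟨M, hM⟩
    -- The bound extends from the rational combinations of the pairs `(e n, conj (f n))` to the
    -- closure in `F × ℂ` of the set of these, which contains all the linear combinations.
    have h1 : ∀ p ∈ Submodule.span ℂ (Set.range fun n => (e n, starRingEnd ℂ (f n))),
        ‖p.2‖ ≤ M * ‖p.1‖ := by
      intro p hp
      refine closure_minimal (t := {p : F × ℂ | ‖p.2‖ ≤ M * ‖p.1‖}) ?_
        (isClosed_le (by fun_prop) (by fun_prop)) (span_subset_closure_ratComb _ hp)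
      rintro _ ⟨l, rfl⟩
      have h2 := map_ratComb (LinearMap.fst ℂ F ℂ) (fun n => (e n, starRingEnd ℂ (f n))) l
      have h3 := map_ratComb (LinearMap.snd ℂ F ℂ) (fun n => (e n, starRingEnd ℂ (f n))) l
      simp only [LinearMap.fst_apply, LinearMap.snd_apply] at h2 h3
      change ‖_‖ ≤ M * ‖_‖
      rw [h2, h3]
      exact hM l
    have h4 : ∀ c : ℕ →₀ ℂ, ‖Finsupp.linearCombination ℂ (fun n => starRingEnd ℂ (f n)) c‖ ≤
        M * ‖Finsupp.linearCombination ℂ e c‖ := by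
      intro c
      have h5 := h1 (Finsupp.linearCombination ℂ (fun n => (e n, starRingEnd ℂ (f n))) c)
        (Finsupp.mem_span_range_iff_exists_finsupp.2 ⟨c, rfl⟩)
      have h6 := Finsupp.apply_linearCombination ℂ (LinearMap.fst ℂ F ℂ)
        (fun n => (e n, starRingEnd ℂ (f n))) c
      have h7 := Finsupp.apply_linearCombination ℂ (LinearMap.snd ℂ F ℂ)
        (fun n => (e n, starRingEnd ℂ (f n))) c
      simp only [LinearMap.fst_apply, LinearMap.snd_apply, Function.comp_def] at h6 h7
      rwa [h6, h7] at h5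
    have h8 : DenseRange (Finsupp.linearCombination ℂ e) := by
      rwa [DenseRange, ← LinearMap.coe_range, Finsupp.range_linearCombination]
    let ψ : F →L[ℂ] ℂ := (Finsupp.linearCombination ℂ (fun n => starRingEnd ℂ (f n))).extendOfNorm
      (Finsupp.linearCombination ℂ e)
    have h9 : ∀ n, ψ (e n) = starRingEnd ℂ (f n) := by
      intro n
      have := LinearMap.extendOfNorm_eq h8 ⟨M, h4⟩ (Finsupp.single n 1)
      simpa using this
    refine ⟨(InnerProductSpace.toDual ℂ F).symm ψ, fun n => ?_⟩
    rw [← inner_conj_symm, InnerProductSpace.toDual_symm_apply, h9, Complex.conj_conj]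

theorem measurable_inner_ratComb {X : Type*} [MeasurableSpace X] {F : X → Type*}
    [∀ x, NormedAddCommGroup (F x)] [∀ x, InnerProductSpace ℂ (F x)] {e : ℕ → ∀ x, F x}
    (hgram : ∀ m n, Measurable fun x => inner ℂ (e m x) (e n x)) (l l' : List (ℕ × ℕ)) :
    Measurable fun x => inner ℂ (ratComb ℂ (fun n => e n x) l) (ratComb ℂ (fun n => e n x) l') := by
  have h : ∀ n, Measurable fun x => inner ℂ (ratComb ℂ (fun n => e n x) l) (e n x) := by
    intro n
    induction l with
    | nil => simp
    | cons a l ih =>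
      simp only [ratComb_cons, inner_add_left, inner_smul_left]
      exact ((hgram _ _).const_mul _).add ih
  induction l' with
  | nil => simp
  | cons b l' ih =>
    simp only [ratComb_cons, inner_add_right, inner_smul_right]
    exact ((h _).const_mul _).add ih

namespace MeasuredGroupoid

/-- A family of Hilbert spaces with total sequences whose Gram matrices are Borel is a Hilbert
bundle. The total space carries the Borel structure induced by `(x, v) ↦ (x, (⟨e n x, v⟩)ₙ)`; it is
standard because the range of this map is Borel by `exists_forall_inner_eq_iff`. -/
theorem exists_hilbertBundle {X : Type u} [MeasurableSpace X] [StandardBorelSpace X]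
    (F : X → Type w) [i1 : ∀ x, NormedAddCommGroup (F x)] [i2 : ∀ x, InnerProductSpace ℂ (F x)]
    [i3 : ∀ x, CompleteSpace (F x)] (e : ℕ → ∀ x, F x)
    (hgram : ∀ m n, Measurable fun x => inner ℂ (e m x) (e n x))
    (hd : ∀ x, Dense (Submodule.span ℂ (Set.range fun n => e n x) : Set (F x))) :
    ∃ H : HilbertBundle.{0, w} ℂ X, ∃ Φ : ∀ x, F x ≃ₗᵢ[ℂ] H.Fiber x,
      ∀ n x, H.fund n x = Φ x (e n x) := by
  let j : (Σ x, F x) → X × (ℕ → ℂ) := fun z => (z.1, fun n => inner ℂ (e n z.1) z.2)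
  have hsep : ∀ (x : X) (v v' : F x), (∀ n, inner ℂ (e n x) v = inner ℂ (e n x) v') → v = v' := by
    intro x v v' h
    rw [← sub_eq_zero]
    refine (hd x).eq_zero_of_inner_right ℂ fun ζ hζ => ?_
    refine Submodule.span_induction (p := fun z _ => inner ℂ z (v - v') = 0) ?_ (by simp) ?_ ?_ hζ
    · rintro _ ⟨n, rfl⟩
      simp only [inner_sub_right, h n, sub_self]
    · intro a b _ _ ha hb
      rw [inner_add_left, ha, hb, add_zero]
    · intro c a _ ha
      rw [inner_smul_left, ha, mul_zero]
  have hj : Function.Injective j := by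
    rintro ⟨x, a⟩ ⟨y, c⟩ h
    obtain rfl : x = y := congrArg Prod.fst h
    have h2 := congrArg Prod.snd h
    obtain rfl : a = c := hsep x a c fun n => congrFun h2 n
    rfl
  have hrange : MeasurableSet (Set.range j) := by
    have h1 : Set.range j = ⋃ M : ℕ, ⋂ l, {q : X × (ℕ → ℂ) |
        ‖ratComb ℂ (fun n => starRingEnd ℂ (q.2 n)) l‖ ≤
          M * ‖ratComb ℂ (fun n => e n q.1) l‖} := by
      ext ⟨x, f⟩
      simp only [Set.mem_iUnion, Set.mem_iInter, Set.mem_ofPred_eq,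
        ← exists_forall_inner_eq_iff (hd x)]
      constructor
      · rintro ⟨⟨y, a⟩, h⟩
        obtain rfl : y = x := congrArg Prod.fst h
        exact ⟨a, fun n => congrFun (congrArg Prod.snd h) n⟩
      · rintro ⟨a, ha⟩
        exact ⟨⟨x, a⟩, Prod.ext rfl (funext ha)⟩
    rw [h1]
    refine MeasurableSet.iUnion fun M => MeasurableSet.iInter fun l => measurableSet_le ?_ ?_
    · refine Measurable.norm ?_
      induction l with
      | nil => simp
      | cons a l ih =>
        simp only [ratComb_cons]
        have h2 : Measurable fun q : X × (ℕ → ℂ) => starRingEnd ℂ (q.2 a.2) :=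
          Complex.continuous_conj.measurable.comp ((measurable_pi_apply _).comp measurable_snd)
        exact (h2.const_mul _).add ih
    · refine Measurable.const_mul ?_ _
      have h2 := (Complex.measurable_re.comp (measurable_inner_ratComb hgram l l)).sqrt
      simp only [@norm_eq_sqrt_re_inner ℂ]
      exact h2.comp measurable_fst
  let mT : MeasurableSpace (Σ x, F x) := MeasurableSpace.comap j inferInstance
  have hmj : Measurable j := comap_measurable j
  have hmeas : ∀ ξ : ∀ x, F x, (∀ n, Measurable fun x => inner ℂ (e n x) (ξ x)) →
      Measurable fun x => (⟨x, ξ x⟩ : Σ x, F x) := by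
    intro ξ hξ
    exact measurable_comap_iff.2 (measurable_id.prodMk (measurable_pi_lambda _ hξ))
  let H : HilbertBundle.{0, w} ℂ X :=
    { Fiber := F
      normed := i1
      innerProduct := i2
      complete := i3
      borel := mT
      standard := standardBorelSpace_of_measurableEmbedding hj hrange
      measurableSet_iff := fun A =>
        ⟨fun hA => (measurable_fst.comp hmj) hA, fun hA => hmeas 0 (fun n => by simp) hA⟩
      fund := e
      measurable_fund := fun n => hmeas (e n) fun m => hgram m n
      measurable_inner := fun n => (measurable_pi_apply n).comp (measurable_snd.comp hmj)
      measurable_gram := hgram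
      separating := hsep }
  exact ⟨H, fun x => LinearIsometryEquiv.refl ℂ (F x), fun n x => rfl⟩

end MeasuredGroupoid

open scoped ComplexOrder in
/-- The Hilbert space of the Gaussian kernels on a separable Hilbert space `V` of any universe has
a model in `Type`, since it is spanned by the vectors at the points of a dense sequence. -/
theorem exists_gaussVec (𝕜 : Type*) [RCLike 𝕜] {V : Type w} [NormedAddCommGroup V]
    [InnerProductSpace 𝕜 V] {d : ℕ → V} (hd : DenseRange d) :
    ∃ (E : Type) (_ : NormedAddCommGroup E) (_ : InnerProductSpace ℂ E) (_ : CompleteSpace E)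
      (e : ℕ × V → E), (∀ a b, inner ℂ (e a) (e b) = gaussKernel V a b) ∧
        Dense (Submodule.span ℂ (Set.range fun i : ℕ × ℕ => e (i.1, d i.2)) : Set E) := by
  have hk := posSemidef_map_ofReal (posSemidef_gaussKernel 𝕜 (V := V))
  obtain ⟨E, _, _, _, e, he, hde⟩ := exists_hilbertSpace_of_posSemidef hk
  obtain ⟨E', _, _, _, e', he', hde'⟩ := exists_hilbertSpace_of_posSemidef
    (hk.submatrix fun i : ℕ × ℕ => (i.1, d i.2))
  have hde2 : Dense (Submodule.span ℂ (Set.range fun i : ℕ × ℕ => e (i.1, d i.2)) : Set E) := by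
    have h1 : Submodule.span ℂ (Set.range e) ≤
        (Submodule.span ℂ (Set.range fun i : ℕ × ℕ => e (i.1, d i.2))).topologicalClosure := by
      rw [Submodule.span_le]
      rintro _ ⟨⟨n, v⟩, rfl⟩
      refine hd.induction_on (p := fun v => e (n, v) ∈ (Submodule.span ℂ
        (Set.range fun i : ℕ × ℕ => e (i.1, d i.2))).topologicalClosure) v
        ((Submodule.isClosed_topologicalClosure _).preimage (continuous_gaussVec he n)) fun i => ?_
      exact Submodule.le_topologicalClosure _ (Submodule.subset_span ⟨(n, i), rfl⟩)
    rw [Submodule.dense_iff_topologicalClosure_eq_top] at hde ⊢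
    rw [eq_top_iff, ← hde]
    exact Submodule.topologicalClosure_minimal _ h1 (Submodule.isClosed_topologicalClosure _)
  obtain ⟨Φ, hΦ⟩ := exists_linearIsometryEquiv_of_gram_eq
    (e := fun i : ℕ × ℕ => e (i.1, d i.2)) (e' := e') (fun i j => by rw [he, he']; rfl) hde2 hde'
  refine ⟨E', inferInstance, inferInstance, inferInstance, fun a => Φ (e a), fun a b => ?_, ?_⟩
  · rw [Φ.inner_map_map, he]
    rfl
  · simpa only [hΦ] using hde'

namespace MeasuredGroupoid

variable {X : Type u} [MeasurableSpace X] [Groupoid.{v} X] [MeasurableSpace (Arr X)]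

/-! ### The Gaussian bundle of an affine action -/

/-- The bundle of the Hilbert spaces of the Gaussian kernels on the fibres of a Hilbert bundle. -/
theorem exists_gaussBundle {X : Type u} [MeasurableSpace X] [StandardBorelSpace X]
    {𝕜 : Type k} [RCLike 𝕜] (H : HilbertBundle.{k, w} 𝕜 X) :
    ∃ (K : HilbertBundle.{0, 0} ℂ X) (e : ∀ x, ℕ × H.Fiber x → K.Fiber x),
      (∀ x a b, inner ℂ (e x a) (e x b) = gaussKernel (H.Fiber x) a b) ∧
      ∀ n i x, K.fund (Nat.pair n i) x = e x (n, H.denseSec i x) := by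
  choose E i1 i2 i3 e he hd using fun x =>
    exists_gaussVec 𝕜 (HilbertBundle.denseRange_denseSec (H := H) x)
  have hgram : ∀ m n : ℕ, Measurable fun x =>
      inner ℂ (e x (m.unpair.1, H.denseSec m.unpair.2 x))
        (e x (n.unpair.1, H.denseSec n.unpair.2 x)) := by
    intro m n
    simp only [he]
    refine Complex.measurable_ofReal.comp ?_
    simp only [gaussKernel, Matrix.of_apply]
    split_ifs
    · have := ((HilbertBundle.isPullbackSection_denseSec (H := H) measurable_id m.unpair.2).sub
        (HilbertBundle.isPullbackSection_denseSec measurable_id n.unpair.2)).measurable_norm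
      exact ((this.pow_const 2).div_const _).neg.exp
    · exact measurable_const
  have hdense : ∀ x, Dense (Submodule.span ℂ (Set.range fun n : ℕ =>
      e x (n.unpair.1, H.denseSec n.unpair.2 x)) : Set (E x)) := by
    intro x
    have h1 : Function.Surjective Nat.unpair := Nat.pairEquiv.symm.surjective
    have h2 := h1.range_comp fun i : ℕ × ℕ => e x (i.1, H.denseSec i.2 x)
    rw [Function.comp_def] at h2
    rw [h2]
    exact hd x
  obtain ⟨K, Φ, hΦ⟩ := exists_hilbertBundle E
    (fun i x => e x (i.unpair.1, H.denseSec i.unpair.2 x)) hgram hdense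
  refine ⟨K, fun x a => Φ x (e x a), fun x a b => ?_, fun n i x => ?_⟩
  · rw [(Φ x).inner_map_map, he]
  · rw [hΦ, Nat.unpair_pair]

theorem dense_span_gaussVec {X : Type u} [MeasurableSpace X] {𝕜 : Type k} [RCLike 𝕜]
    {H : HilbertBundle.{k, w} 𝕜 X} {K : HilbertBundle.{0, 0} ℂ X}
    {e : ∀ x, ℕ × H.Fiber x → K.Fiber x}
    (hfund : ∀ n i x, K.fund (Nat.pair n i) x = e x (n, H.denseSec i x)) (x : X) :
    Dense (Submodule.span ℂ (Set.range (e x)) : Set (K.Fiber x)) := by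
  refine (HilbertBundle.dense_span_fund (H := K) x).mono (Submodule.span_mono ?_)
  rintro _ ⟨i, rfl⟩
  exact ⟨_, ((congrArg (fun j => K.fund j x) (Nat.pair_unpair i)).symm.trans (hfund _ _ x)).symm⟩

section

variable {ν : Measure (Arr X)}

theorem ae_mem_of_isConull [BorelGroupoid X] (hsymm : MeasureEquiv ν (ν.map Arr.inv)) {U : Set X}
    (hU : IsConull ν U) : ∀ᵐ γ ∂ν, γ.r ∈ U ∧ γ.s ∈ U := by
  have h1 : ν {γ : Arr X | γ.r ∉ U} = 0 := by
    have := hU.2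
    rwa [baseMeasure, Measure.map_apply BorelGroupoid.measurable_r hU.1.compl] at this
  have h2 : ν {γ : Arr X | γ.s ∉ U} = 0 := by
    refine hsymm.1 ?_
    exact (Measure.map_apply BorelGroupoid.measurable_inv
      (BorelGroupoid.measurable_s hU.1.compl)).trans h1
  exact (measure_eq_zero_iff_ae_notMem.1 h1).and (measure_eq_zero_iff_ae_notMem.1 h2) |>.mono
    fun γ h => ⟨not_not.1 h.1, not_not.1 h.2⟩

theorem ae_of_ae_baseMeasure [BorelGroupoid X] {p : X → Prop} (h : ∀ᵐ x ∂(baseMeasure ν), p x) :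
    ∀ᵐ γ ∂ν, p γ.r :=
  ae_of_ae_map BorelGroupoid.measurable_r.aemeasurable h

variable {𝕜 : Type k} [RCLike 𝕜] {H : HilbertBundle.{k, w} 𝕜 X}

/-- An affine action by isometries induces a representation in the Gaussian bundle, given by
`e (n, v) ↦ e (n, α(γ) v)`. -/
theorem AffineAction.exists_gaussRep [StandardBorelSpace X] [BorelGroupoid X]
    (α : AffineAction ν H)
    {K : HilbertBundle.{0, 0} ℂ X} {e : ∀ x, ℕ × H.Fiber x → K.Fiber x}
    (he : ∀ x a b, inner ℂ (e x a) (e x b) = gaussKernel (H.Fiber x) a b)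
    (hfund : ∀ n i x, K.fund (Nat.pair n i) x = e x (n, H.denseSec i x)) :
    ∃ (L : GroupoidRep ν K) (U : Set X), IsConull ν U ∧ ∀ x ∈ U, ∀ y ∈ U, ∀ g : x ⟶ y,
      (∃ f : H.Fiber y ≃ᵃⁱ[𝕜] H.Fiber x, ∀ a, α.act g a = f a) ∧
      ∃ Φ : K.Fiber y ≃ₗᵢ[ℂ] K.Fiber x, (∀ a, L.op g a = Φ a) ∧
        ∀ a, Φ (e y a) = e x (a.1, α.act g a.2) := by
  classical
  obtain ⟨U, hU, hiso, hone, hmul⟩ := α.strict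
  have hdense := dense_span_gaussVec hfund
  have hΦ : ∀ (x y : X) (g : x ⟶ y), x ∈ U ∧ y ∈ U → ∃ Φ : K.Fiber y ≃ₗᵢ[ℂ] K.Fiber x,
      ∀ a, Φ (e y a) = e x (a.1, α.act g a.2) := by
    rintro x y g ⟨hx, hy⟩
    obtain ⟨f, hf⟩ := hiso x hx y hy g
    refine exists_linearIsometryEquiv_of_gram_eq (fun a b => ?_) (hdense y) ?_
    · rw [he, he]
      simp only [gaussKernel, Matrix.of_apply, hf, ← dist_eq_norm, f.dist_map]
    · have hs : Function.Surjective fun a : ℕ × H.Fiber y => (a.1, α.act g a.2) := by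
        rintro ⟨n, v⟩
        exact ⟨(n, f.symm v), by simp [hf]⟩
      have := hs.range_comp (e x)
      rw [Function.comp_def] at this
      rw [this]
      exact hdense x
  choose Φ hΦe using hΦ
  let op : ∀ {x y : X}, (x ⟶ y) → (K.Fiber y →L[ℂ] K.Fiber x) := fun {x y} g =>
    if h : x ∈ U ∧ y ∈ U then ((Φ x y g h).toContinuousLinearEquiv : K.Fiber y →L[ℂ] K.Fiber x)
    else 0
  have hop : ∀ {x y : X} (g : x ⟶ y) (h : x ∈ U ∧ y ∈ U) a, op g a = Φ x y g h a := by
    intro x y g h a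
    simp only [op, dif_pos h]
    rfl
  have hope : ∀ {x y : X} (g : x ⟶ y), x ∈ U → y ∈ U → ∀ a,
      op g (e y a) = e x (a.1, α.act g a.2) := by
    intro x y g hx hy a
    rw [hop g ⟨hx, hy⟩, hΦe]
  have hext : ∀ {x y : X} (A B : K.Fiber x →L[ℂ] K.Fiber y), (∀ a, A (e x a) = B (e x a)) →
      ∀ v, A v = B v := by
    intro x y A B h v
    have : A = B := ContinuousLinearMap.ext_on (hdense x) (by rintro _ ⟨a, rfl⟩; exact h a)
    rw [this]
  refine ⟨⟨op, fun m n => ?_, U, hU, ?_, ?_, ?_⟩, U, hU, fun x hx y hy g =>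
    ⟨hiso x hx y hy g, Φ x y g ⟨hx, hy⟩, hop g ⟨hx, hy⟩, hΦe x y g _⟩⟩
  · have hB : MeasurableSet {γ : Arr X | γ.r ∈ U ∧ γ.s ∈ U} :=
      (BorelGroupoid.measurable_r hU.1).inter (BorelGroupoid.measurable_s hU.1)
    have h1 := ((α.measurable_act _ (HilbertBundle.isPullbackSection_denseSec (H := H)
      measurable_id n.unpair.2)).sub (HilbertBundle.isPullbackSection_denseSec (H := H)
      BorelGroupoid.measurable_r m.unpair.2)).measurable_norm
    have h2 : Measurable fun γ : Arr X => gaussKernel (H.Fiber γ.r)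
        (n.unpair.1, α.act γ.hom (H.denseSec n.unpair.2 γ.s))
        (m.unpair.1, H.denseSec m.unpair.2 γ.r) := by
      simp only [gaussKernel, Matrix.of_apply]
      split_ifs
      · exact ((h1.pow_const 2).div_const _).neg.exp
      · exact measurable_const
    have h3 : (fun γ : Arr X => inner ℂ (op γ.hom (K.fund n γ.s)) (K.fund m γ.r)) = fun γ : Arr X =>
        if γ.r ∈ U ∧ γ.s ∈ U then ((gaussKernel (H.Fiber γ.r)
          (n.unpair.1, α.act γ.hom (H.denseSec n.unpair.2 γ.s))
          (m.unpair.1, H.denseSec m.unpair.2 γ.r) : ℝ) : ℂ) else 0 := by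
      funext γ
      have h3 := hfund n.unpair.1 n.unpair.2 γ.s
      have h4 := hfund m.unpair.1 m.unpair.2 γ.r
      rw [Nat.pair_unpair] at h3 h4
      split_ifs with h
      · rw [h3, h4, hope γ.hom h.1 h.2, he]
      · have : op γ.hom = 0 := dif_neg h
        rw [this]
        simp
    rw [h3]
    exact Measurable.ite hB (Complex.measurable_ofReal.comp h2) measurable_const
  · intro x hx y hy g
    exact ⟨Φ x y g ⟨hx, hy⟩, hop g ⟨hx, hy⟩⟩
  · intro x hx a
    refine hext (op (𝟙 x)) (ContinuousLinearMap.id ℂ _) (fun a => ?_) a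
    rw [hope (𝟙 x) hx hx, hone x hx]
    rfl
  · intro x hx y hy z hz g h a
    refine hext (op (g ≫ h)) (op g ∘L op h) (fun a => ?_) a
    rw [ContinuousLinearMap.comp_apply, hope _ hx hz, hope _ hy hz, hope _ hx hy,
      hmul x hx y hy z hz]

/-- The widths `n + 1` of the Gaussian kernels tend to infinity, so that the vectors at two given
points get close to each other. -/
theorem tendsto_norm_gaussVec_sub {V E : Type*} [NormedAddCommGroup V]
    [NormedAddCommGroup E] [InnerProductSpace ℂ E] {e : ℕ × V → E}
    (he : ∀ a b, inner ℂ (e a) (e b) = gaussKernel V a b) (v w : V) :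
    Tendsto (fun n => ‖e (n, v) - e (n, w)‖) atTop (𝓝 0) := by
  have h1 : Tendsto (fun n : ℕ => 2 - 2 * gaussKernel V (n, v) (n, w)) atTop (𝓝 0) := by
    simp only [gaussKernel, Matrix.of_apply, if_true]
    have h2 : Tendsto (fun n : ℕ => -(‖v - w‖ ^ 2 / ((n : ℝ) + 1))) atTop (𝓝 0) := by
      have := (tendsto_one_div_add_atTop_nhds_zero_nat (𝕜 := ℝ)).const_mul (-‖v - w‖ ^ 2)
      rw [mul_zero] at this
      refine this.congr fun n => ?_
      ring
    have h3 := ((Real.continuous_exp.tendsto 0).comp h2).const_mul 2 |>.const_sub 2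
    simpa using h3
  have h2 := h1.sqrt
  simpa only [← norm_gaussVec_sub_sq he, Real.sqrt_sq (norm_nonneg _), Real.sqrt_zero] using h2

/-- Property T yields an invariant unit section of the Gaussian bundle, whose first nonempty
superlevel sets are permuted by the affine action; their circumcenters form an invariant section. -/
theorem AffineAction.hasInvariantSection_of_hasPropertyT [StandardBorelSpace X] [BorelGroupoid X]
    (hsymm : MeasureEquiv ν (ν.map Arr.inv)) (hT : HasPropertyT.{0} ν) (α : AffineAction ν H) :
    α.HasInvariantSection := by
  classical
  obtain ⟨K, e, he, hfund⟩ := exists_gaussBundle H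
  have hdense := dense_span_gaussVec hfund
  obtain ⟨L, U, hU, hL⟩ := α.exists_gaussRep he hfund
  have hUae := ae_mem_of_isConull hsymm hU
  have hA : L.AlmostHasUnitInvariantSections := by
    refine ⟨fun n x => e x (n, 0), fun n => ⟨?_, ?_⟩, ?_⟩
    · have h1 : (fun x => e x (n, 0)) = fun x => K.fund (Nat.pair n 0) x := by
        funext x
        rw [hfund, HilbertBundle.denseSec_zero]
      exact (congrArg K.IsSection h1).mpr (K.measurable_fund _)
    · exact Eventually.of_forall fun x => norm_gaussVec (he x) _
    · filter_upwards [hUae] with γ hγ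
      obtain ⟨-, Φ, hΦ, hΦe⟩ := hL γ.r hγ.1 γ.s hγ.2 γ.hom
      simp only [GroupoidRep.coboundary, hΦ, hΦe]
      exact tendsto_norm_gaussVec_sub (he γ.r) _ _
  obtain ⟨η, ⟨hη, hη1⟩, hinv⟩ := hT K L hA
  have hmS : ∀ i k, MeasurableSet {x | H.denseSec i x ∈ superlevel (e x) (η x) k} := by
    intro i k
    have h1 : {x | H.denseSec i x ∈ superlevel (e x) (η x) k} =
        ⋃ n, {x | 1 / ((k : ℝ) + 1) < ‖inner ℂ (K.fund (Nat.pair n i) x) (η x)‖} := by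
      ext x
      simp [superlevel, hfund]
    rw [h1]
    exact MeasurableSet.iUnion fun n => measurableSet_lt measurable_const
      (HilbertBundle.isSection_iff.1 hη _).norm
  have hme : ∀ k, MeasurableSet {x | superlevel (e x) (η x) k = ∅} := by
    intro k
    have h1 : {x | superlevel (e x) (η x) k = ∅} =
        ⋂ i, {x | H.denseSec i x ∈ superlevel (e x) (η x) k}ᶜ := by
      ext x
      simp only [Set.mem_iInter, Set.mem_compl_iff, Set.mem_ofPred_eq]
      refine ⟨fun h i => by simp [h], fun h => Set.not_nonempty_iff_eq_empty.1 fun hne => ?_⟩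
      obtain ⟨i, hi⟩ := (HilbertBundle.denseRange_denseSec (H := H) x).exists_mem_open
        (isOpen_superlevel (he x) (η x) k) hne
      exact h i hi
    rw [h1]
    exact MeasurableSet.iInter fun i => (hmS i k).compl
  have hQ : MeasurableSet {x | ∃ k, (superlevel (e x) (η x) k).Nonempty} := by
    have h1 : {x | ∃ k, (superlevel (e x) (η x) k).Nonempty} =
        ⋃ k, {x | superlevel (e x) (η x) k = ∅}ᶜ := by
      ext x
      simp [Set.nonempty_iff_ne_empty]
    rw [h1]
    exact MeasurableSet.iUnion fun k => (hme k).compl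
  -- On the null set where `η` vanishes, any nonempty bounded open set will do.
  let S : ∀ x, Set (H.Fiber x) := fun x =>
    if ∃ k, (superlevel (e x) (η x) k).Nonempty then firstSuperlevel (e x) (η x)
    else Metric.ball 0 1
  have hS : ∀ x, (S x).Nonempty ∧ Bornology.IsBounded (S x) ∧ IsOpen (S x) := by
    intro x
    simp only [S]
    split_ifs with h
    · obtain ⟨k, hk, hne⟩ := exists_firstSuperlevel_eq h
      rw [hk]
      exact ⟨hne, isBounded_superlevel (he x) (hdense x) _ _, isOpen_superlevel (he x) _ _⟩
    · exact ⟨⟨0, by simp⟩, Metric.isBounded_ball, Metric.isOpen_ball⟩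
  refine ⟨fun x => circumcenter (S x), HilbertBundle.isSection_circumcenter (fun x => (hS x).1)
    (fun x => (hS x).2.1) (fun x => (hS x).2.2) fun i => ?_, ?_⟩
  · have h1 : {x | H.denseSec i x ∈ S x} =
        ({x | ∃ k, (superlevel (e x) (η x) k).Nonempty} ∩
          ⋃ k, ({x | H.denseSec i x ∈ superlevel (e x) (η x) k} ∩
            ⋂ k' : ℕ, ⋂ _ : k' < k, {x | superlevel (e x) (η x) k' = ∅})) ∪
        ({x | ∃ k, (superlevel (e x) (η x) k).Nonempty}ᶜ ∩ {x | ‖H.denseSec i x‖ < 1}) := by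
      ext x
      by_cases h : ∃ k, (superlevel (e x) (η x) k).Nonempty
      · simp [S, h, firstSuperlevel]
      · simp [S, h]
    rw [h1]
    refine (hQ.inter (MeasurableSet.iUnion fun k => (hmS i k).inter (MeasurableSet.iInter
      fun k' => MeasurableSet.iInter fun _ => hme k'))).union (hQ.compl.inter ?_)
    exact measurableSet_lt (HilbertBundle.isPullbackSection_denseSec (H := H) measurable_id
      i).measurable_norm measurable_const
  · filter_upwards [hUae, hinv, ae_of_ae_baseMeasure hη1] with γ hγ hγη hγ1
    obtain ⟨⟨f, hf⟩, Φ, hΦ, hΦe⟩ := hL γ.r hγ.1 γ.s hγ.2 γ.hom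
    rw [hΦ] at hγη
    have hsurj : Function.Surjective (α.act γ.hom) := fun v => ⟨f.symm v, by simp [hf]⟩
    have hη0 : ∀ x, η x ≠ 0 → S x = firstSuperlevel (e x) (η x) := fun x hx =>
      if_pos (exists_superlevel_nonempty (hdense x) hx)
    have hr0 : η γ.r ≠ 0 := by
      rw [← norm_ne_zero_iff, hγ1]
      exact one_ne_zero
    have hs0 : η γ.s ≠ 0 := by
      rintro h
      rw [h, map_zero] at hγη
      exact hr0 hγη
    have hSγ : S γ.r = α.act γ.hom '' S γ.s := by
      rw [hη0 _ hr0, hη0 _ hs0, hγη, firstSuperlevel_image hsurj hΦe]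
    rw [hSγ]
    refine circumcenter_image 𝕜 (fun a b => ?_) hsurj (hS _).1 (hS _).2.1
    rw [hf, hf, ← dist_eq_norm, f.dist_map, dist_eq_norm]

end

/-! ### Atoms of the disintegration -/

section Arr

variable {X : Type u} [Groupoid.{v} X]

theorem Arr.inv_inv (γ : Arr X) : γ.inv.inv = γ := by
  obtain ⟨x, y, g⟩ := γ
  simp [Arr.inv, Groupoid.inv_eq_inv]

theorem Arr.mul_eq_self_iff (γ η : Arr X) (h : γ.s = η.r) :
    Arr.mul γ η h = γ ↔ η = Arr.unit γ.s := by
  obtain ⟨x, y, g⟩ := γ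
  obtain ⟨y', z, f⟩ := η
  obtain rfl : y = y' := h
  simp only [Arr.mul, Arr.unit, eqToHom_refl, Category.id_comp]
  constructor
  · intro h
    obtain rfl : z = y := congrArg (fun γ : Arr X => γ.s) h
    have h2 : g ≫ f = g := by simpa using h
    have h3 : f = 𝟙 _ := by rw [← cancel_epi g, h2, Category.comp_id]
    rw [h3]
  · intro h
    obtain rfl : z = y := congrArg (fun γ : Arr X => γ.s) h
    obtain rfl : f = 𝟙 _ := by simpa using h
    rw [Category.comp_id]

end Arr

variable {X : Type u} [MeasurableSpace X] [Groupoid.{v} X] [MeasurableSpace (Arr X)]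

theorem leftTranslate_singleton [StandardBorelSpace X] [StandardBorelSpace (Arr X)]
    [BorelGroupoid X] (γ : Arr X) (ρ : Measure (Arr X)) :
    leftTranslate γ ρ {γ} = ρ {Arr.unit γ.s} := by
  have hms : MeasurableSet {η : Arr X | γ.s = η.r} :=
    measurableSet_eq_fun measurable_const BorelGroupoid.measurable_r
  have hmul : Measurable fun η : {η : Arr X // γ.s = η.r} => Arr.mul γ η.1 η.2 := by
    have h1 : Measurable fun η : {η : Arr X // γ.s = η.r} =>
        (⟨(γ, η.1), η.2⟩ : {p : Arr X × Arr X // p.1.s = p.2.r}) :=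
      (measurable_const.prodMk measurable_subtype_coe).subtype_mk
    exact BorelGroupoid.measurable_mul.comp h1
  rw [leftTranslate, Measure.map_apply hmul (measurableSet_singleton γ),
    show ρ.comap (Subtype.val : {η : Arr X // γ.s = η.r} → Arr X) _ = _ from
      (MeasurableEmbedding.subtype_coe hms).comap_apply ρ _]
  congr 1
  ext η
  simp only [Set.mem_image, Set.mem_preimage, Set.mem_singleton_iff, Arr.mul_eq_self_iff]
  constructor
  · rintro ⟨η', h, rfl⟩
    exact h
  · rintro rfl
    exact ⟨⟨Arr.unit γ.s, rfl⟩, rfl, rfl⟩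

theorem IsConull.of_ae {ν : Measure (Arr X)} {p : X → Prop} (hm : MeasurableSet {x | p x})
    (h : ∀ᵐ x ∂(baseMeasure ν), p x) : IsConull ν {x | p x} :=
  ⟨hm, h⟩

theorem IsConull.inter {ν : Measure (Arr X)} {U V : Set X} (hU : IsConull ν U) (hV : IsConull ν V) :
    IsConull ν (U ∩ V) := by
  refine ⟨hU.1.inter hV.1, ?_⟩
  rw [Set.compl_inter]
  exact measure_union_null hU.2 hV.2

section Fiber

variable [StandardBorelSpace (Arr X)] (μ : Measure (Arr X)) [IsProbabilityMeasure μ]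

instance : IsMarkovKernel (fiberMeasure μ) := by
  have : Nonempty (Arr X) := nonempty_of_isProbabilityMeasure μ
  unfold fiberMeasure
  infer_instance

instance [BorelGroupoid X] : IsProbabilityMeasure (baseMeasure μ) :=
  Measure.isProbabilityMeasure_map BorelGroupoid.measurable_r.aemeasurable

theorem baseMeasure_compProd_fiberMeasure [BorelGroupoid X] :
    baseMeasure μ ⊗ₘ fiberMeasure μ = μ.map fun γ => (γ.r, γ) := by
  have : Nonempty (Arr X) := nonempty_of_isProbabilityMeasure μ
  exact compProd_map_condDistrib aemeasurable_id

variable {μ}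

theorem ae_ae_fiberMeasure [BorelGroupoid X] {p : X × Arr X → Prop}
    (hp : MeasurableSet {q | p q}) :
    (∀ᵐ x ∂(baseMeasure μ), ∀ᵐ γ ∂(fiberMeasure μ x), p (x, γ)) ↔ ∀ᵐ γ ∂μ, p (γ.r, γ) := by
  rw [← Measure.ae_compProd_iff hp, baseMeasure_compProd_fiberMeasure]
  exact ae_map_iff (BorelGroupoid.measurable_r.prodMk measurable_id).aemeasurable hp

variable (μ) in
theorem measurable_fiberMeasure_singleton :
    Measurable fun q : X × Arr X => fiberMeasure μ q.1 {q.2} := by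
  have h1 : MeasurableSet {q : (X × Arr X) × Arr X | q.2 = q.1.2} :=
    measurableSet_eq_fun measurable_snd (measurable_snd.comp measurable_fst)
  exact Kernel.measurable_kernel_prodMk_left
    (κ := (fiberMeasure μ).comap Prod.fst measurable_fst) h1

/-- If the fibres of `r` are countable, then the fibre measures are atomic. -/
theorem ae_fiberMeasure_singleton_ne_zero [StandardBorelSpace X] [BorelGroupoid X] {U : Set X}
    (hU : MeasurableSet U) (hUμ : ∀ᵐ γ ∂μ, γ.r ∈ U ∧ γ.s ∈ U)
    (hc : ∀ x ∈ U, {γ : Arr X | γ.r = x ∧ γ.s ∈ U}.Countable) :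
    ∀ᵐ γ ∂μ, fiberMeasure μ γ.r {γ} ≠ 0 := by
  refine (ae_ae_fiberMeasure (p := fun q => fiberMeasure μ q.1 {q.2} ≠ 0)
    (measurable_fiberMeasure_singleton μ (measurableSet_singleton 0)).compl).1 ?_
  have h1 : MeasurableSet {q : X × Arr X | q.2.r = q.1 ∧ q.1 ∈ U ∧ q.2.s ∈ U} :=
    (measurableSet_eq_fun (BorelGroupoid.measurable_r.comp measurable_snd) measurable_fst).inter
      ((measurable_fst hU).inter ((BorelGroupoid.measurable_s.comp measurable_snd) hU))
  have h2 := (ae_ae_fiberMeasure (μ := μ) (p := fun q => q.2.r = q.1 ∧ q.1 ∈ U ∧ q.2.s ∈ U) h1).2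
    (hUμ.mono fun γ h => ⟨rfl, h⟩)
  filter_upwards [h2] with x hx
  by_cases hxU : x ∈ U
  · have h3 : fiberMeasure μ x {γ | (γ.r = x ∧ γ.s ∈ U) ∧ fiberMeasure μ x {γ} = 0} = 0 := by
      have h4 : {γ | (γ.r = x ∧ γ.s ∈ U) ∧ fiberMeasure μ x {γ} = 0}.Countable :=
        (hc x hxU).mono fun γ h => h.1
      rw [← Set.biUnion_of_singleton {γ | (γ.r = x ∧ γ.s ∈ U) ∧ fiberMeasure μ x {γ} = 0},
        measure_biUnion_null_iff h4]
      exact fun γ hγ => hγ.2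
    filter_upwards [hx, measure_eq_zero_iff_ae_notMem.1 h3] with γ h5 h6 h7
    exact h6 ⟨⟨h5.1, h5.2.2⟩, h7⟩
  · filter_upwards [hx] with γ h
    exact absurd h.2.1 hxU

end Fiber

/-! ### Almost everywhere cocycles -/

/-- The definition of a representation asks for this for the fundamental sequence only; any Borel
section is a limit of selections from combinations of it. -/
theorem GroupoidRep.isPullbackSection_op [StandardBorelSpace X] [BorelGroupoid X]
    {ν : Measure (Arr X)} {𝕜 : Type k} [RCLike 𝕜] {H : HilbertBundle.{k, w} 𝕜 X}
    (L : GroupoidRep ν H) {ξ : ∀ x, H.Fiber x} (hξ : H.IsSection ξ) :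
    H.IsPullbackSection (Arr.r : Arr X → X) fun γ => L.op γ.hom (ξ γ.s) := by
  have hfund : ∀ n, H.IsPullbackSection (Arr.r : Arr X → X)
      fun γ => L.op γ.hom (H.fund n γ.s) := by
    intro n
    refine HilbertBundle.isPullbackSection_iff.2 ⟨BorelGroupoid.measurable_r, fun m => ?_⟩
    have := RCLike.continuous_conj.measurable.comp (L.measurable_op m n)
    simpa only [Function.comp_def, inner_conj_symm] using this
  have hdense : ∀ i, H.IsPullbackSection (Arr.r : Arr X → X)
      fun γ => L.op γ.hom (H.denseSec i γ.s) := by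
    intro i
    unfold HilbertBundle.denseSec
    induction Denumerable.ofNat (List (ℕ × ℕ)) i with
    | nil => simpa using HilbertBundle.isPullbackSection_zero BorelGroupoid.measurable_r
    | cons a l ih =>
      simp only [ratComb_cons, map_add, map_smul]
      exact ((hfund _).const_smul _).add ih
  obtain ⟨j, hj, hlim⟩ := hξ.exists_approx
  refine HilbertBundle.isPullbackSection_of_tendsto
    (F := fun m γ => L.op γ.hom (H.denseSec (j m γ.s) γ.s)) (fun m => ?_) fun γ => ?_
  · exact HilbertBundle.isPullbackSection_select
      (F := fun i (γ : Arr X) => L.op γ.hom (H.denseSec i γ.s)) hdense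
      ((hj m).comp BorelGroupoid.measurable_s)
  · exact ((L.op γ.hom).continuous.tendsto _).comp (hlim γ.s)

variable [StandardBorelSpace X] [StandardBorelSpace (Arr X)] [BorelGroupoid X]
  {ν : Measure (Arr X)} [IsProbabilityMeasure ν]

/-- In an `r`-discrete measured groupoid, every element of some inessential reduction is an atom of
the fibre measure: almost every element is one, the atoms at `γ` and at the unit `s(γ)` correspond
to each other under left translation, and `s(γ)` is distributed like `r(γ)`. -/
theorem exists_conull_fiberMeasure_ne_zero (hG : IsMeasuredGroupoid ν) (hdisc : IsRDiscrete ν) :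
    ∃ V, IsConull ν V ∧ ∀ γ : Arr X, γ.r ∈ V → γ.s ∈ V → fiberMeasure ν γ.r {γ} ≠ 0 := by
  obtain ⟨U, hU, hc⟩ := hdisc
  obtain ⟨ν', _, hνν', U', hU', hinv⟩ := hG.invariant
  have hUae := ae_mem_of_isConull hG.symmetric hU
  have hat : ∀ᵐ γ ∂ν, fiberMeasure ν γ.r {γ} ≠ 0 :=
    ae_fiberMeasure_singleton_ne_zero hU.1 hUae hc
  have hat' : ∀ᵐ γ ∂ν', fiberMeasure ν' γ.r {γ} ≠ 0 :=
    ae_fiberMeasure_singleton_ne_zero hU.1 (hνν'.1.ae_le hUae) hc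
  -- The units that are atoms of the fibre measures of `ν'`.
  have hPm : MeasurableSet {x : X | fiberMeasure ν' x {Arr.unit x} ≠ 0} :=
    ((measurable_fiberMeasure_singleton ν').comp
      (measurable_id.prodMk BorelGroupoid.measurable_unit) (measurableSet_singleton 0)).compl
  have hs : ∀ᵐ γ ∂ν, fiberMeasure ν' γ.s {Arr.unit γ.s} ≠ 0 := by
    filter_upwards [hνν'.2.ae_le hat', ae_mem_of_isConull hG.symmetric hU'] with γ h1 h2 h3
    refine h1 ((hinv γ h2.1 h2.2).2 ?_)
    rw [leftTranslate_singleton, h3]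
  have hP : IsConull ν {x : X | fiberMeasure ν' x {Arr.unit x} ≠ 0} := by
    refine IsConull.of_ae hPm ?_
    rw [baseMeasure, ae_map_iff BorelGroupoid.measurable_r.aemeasurable hPm]
    have h1 := hG.symmetric.2.ae_le hs
    exact ae_of_ae_map BorelGroupoid.measurable_inv.aemeasurable h1
  have hA : MeasurableSet {γ : Arr X | fiberMeasure ν γ.r {γ} ≠ 0} :=
    ((measurable_fiberMeasure_singleton ν).comp
      (BorelGroupoid.measurable_r.prodMk measurable_id) (measurableSet_singleton 0)).compl
  -- Almost all fibre measures of `ν'` are carried by the atoms of those of `ν`.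
  have hQ : IsConull ν
      {x : X | fiberMeasure ν' x {γ : Arr X | fiberMeasure ν γ.r {γ} ≠ 0}ᶜ = 0} := by
    refine IsConull.of_ae (((fiberMeasure ν').measurable_coe hA.compl)
      (measurableSet_singleton 0)) ?_
    have h1 := (ae_ae_fiberMeasure (μ := ν')
      (p := fun q => fiberMeasure ν q.2.r {q.2} ≠ 0) (measurable_snd hA)).2 (hνν'.1.ae_le hat)
    have h2 : baseMeasure ν ≪ baseMeasure ν' := hνν'.2.map BorelGroupoid.measurable_r
    exact h2.ae_le h1
  refine ⟨_, (hU'.inter hP).inter hQ, fun γ hr hs => ?_⟩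
  have h1 : fiberMeasure ν' γ.r {γ} ≠ 0 := by
    intro h
    have h2 := (hinv γ hr.1.1 hs.1.1).1 h
    rw [leftTranslate_singleton] at h2
    exact hs.1.2 h2
  by_contra h
  exact h1 (measure_mono_null (by simpa using h) hr.2)

variable {𝕜 : Type k} [RCLike 𝕜] {H : HilbertBundle.{k, w} 𝕜 X} (L : GroupoidRep ν H)

/-- In the `r`-discrete case, an almost everywhere cocycle satisfies the cocycle identity everywhere
on an inessential reduction. -/
theorem exists_conull_cocycle (hG : IsMeasuredGroupoid ν) (hdisc : IsRDiscrete ν)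
    {b : ∀ γ : Arr X, H.Fiber γ.r} (hb : b ∈ L.cocycles) :
    ∃ V, IsConull ν V ∧ ∀ x ∈ V, ∀ y ∈ V, ∀ z ∈ V, ∀ (g : x ⟶ y) (h : y ⟶ z),
      b ⟨x, z, g ≫ h⟩ = b ⟨x, y, g⟩ + L.op g (b ⟨y, z, h⟩) := by
  obtain ⟨V, hV, hatom⟩ := exists_conull_fiberMeasure_ne_zero hG hdisc
  have h1 : ∀ᵐ x ∂(baseMeasure ν), ∀ᵐ p ∂((fiberMeasure ν ×ₖ fiberMeasure ν) x),
      L.CocycleIdentity b (Prod.map Arr.inv id p) :=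
    Measure.ae_ae_of_ae_bind (Kernel.measurable _).aemeasurable (ae_of_ae_map
      (BorelGroupoid.measurable_inv.prodMap measurable_id).aemeasurable hb.2)
  obtain ⟨W, hW, hWm, hW0⟩ := exists_measurable_superset_of_null (ae_iff.1 h1)
  have hWc : IsConull ν Wᶜ := ⟨hWm.compl, by rwa [compl_compl]⟩
  refine ⟨_, hV.inter hWc, fun x hx y hy z hz g h => ?_⟩
  have h2 : ∀ᵐ p ∂((fiberMeasure ν ×ₖ fiberMeasure ν) y),
      L.CocycleIdentity b (Prod.map Arr.inv id p) := by
    by_contra hcon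
    exact hy.2 (hW hcon)
  -- The pair `(g, h)` comes from the atom `(g⁻¹, h)` of the product of fibre measures at `y`.
  have h3 : (fiberMeasure ν ×ₖ fiberMeasure ν) y
      {(Arr.inv (⟨x, y, g⟩ : Arr X), (⟨y, z, h⟩ : Arr X))} ≠ 0 := by
    rw [Kernel.prod_apply, ← Set.singleton_prod_singleton, Measure.prod_prod]
    exact mul_ne_zero (hatom (Arr.inv ⟨x, y, g⟩) hy.1 hx.1) (hatom ⟨y, z, h⟩ hy.1 hz.1)
  have h4 : L.CocycleIdentity b
      (Prod.map Arr.inv id (Arr.inv (⟨x, y, g⟩ : Arr X), (⟨y, z, h⟩ : Arr X))) := by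
    by_contra hcon
    refine h3 (measure_mono_null ?_ (ae_iff.1 h2))
    rintro _ rfl
    exact hcon
  refine h4 x y z g h ?_
  rw [Prod.map_apply, Arr.inv_inv]
  rfl

/-- The affine action `α(γ) v = L(γ) v + b(γ)` defined by an almost everywhere cocycle. -/
theorem exists_affineAction (hG : IsMeasuredGroupoid ν) (hdisc : IsRDiscrete ν)
    {b : ∀ γ : Arr X, H.Fiber γ.r} (hb : b ∈ L.cocycles) :
    ∃ α : AffineAction ν H, ∀ (γ : Arr X) (v : H.Fiber γ.s),
      α.act γ.hom v = L.op γ.hom v + b γ := by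
  obtain ⟨V, hV, hcoc⟩ := exists_conull_cocycle L hG hdisc hb
  obtain ⟨U, hU, hiso, hone, hmul⟩ := L.strict
  refine ⟨⟨fun {x y} g v => L.op g v + b ⟨x, y, g⟩,
    fun ξ hξ => (L.isPullbackSection_op hξ).add hb.1, U ∩ V, hU.inter hV, ?_, ?_, ?_⟩,
    fun γ v => rfl⟩
  · intro x hx y hy g
    obtain ⟨e, he⟩ := hiso x hx.1 y hy.1 g
    refine ⟨e.toAffineIsometryEquiv.trans (AffineIsometryEquiv.constVAdd 𝕜 _ (b ⟨x, y, g⟩)),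
      fun a => ?_⟩
    simp [he, add_comm]
  · intro x hx a
    have h := hcoc x hx.2 x hx.2 x hx.2 (𝟙 x) (𝟙 x)
    rw [Category.comp_id, hone x hx.1, left_eq_add] at h
    simp only [hone x hx.1, h, add_zero]
  · intro x hx y hy z hz g h a
    simp only [hmul x hx.1 y hy.1 z hz.1, hcoc x hx.2 y hy.2 z hz.2, map_add]
    abel

end MeasuredGroupoid

end

open MeasuredGroupoid
theorem theorem4 {X : Type u} [MeasurableSpace X] [StandardBorelSpace X]
    [CategoryTheory.Groupoid.{v} X] [MeasurableSpace (Arr X)] [StandardBorelSpace (Arr X)]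
    [BorelGroupoid X] (ν : Measure (Arr X)) [IsProbabilityMeasure ν]
    (hG : IsMeasuredGroupoid ν) (herg : IsErgodic ν) (hdisc : IsRDiscrete ν)
    (hT : HasPropertyT.{0} ν) (𝕜 : Type k) [RCLike 𝕜] (H : HilbertBundle.{k, w} 𝕜 X) :
    (∀ L : GroupoidRep ν H, Subsingleton L.H1) ∧
      (∀ α : AffineAction ν H, α.HasInvariantSection) := by
  have hα : ∀ α : AffineAction ν H, α.HasInvariantSection := fun α =>
    α.hasInvariantSection_of_hasPropertyT hG.symmetric hT
  refine ⟨fun L => Submodule.Quotient.subsingleton_iff.2 (eq_top_iff.2 fun b _ => ?_), hα⟩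
  obtain ⟨α, hαL⟩ := exists_affineAction L hG hdisc b.2
  obtain ⟨ξ, hξ, hinv⟩ := hα α
  refine ⟨ξ, hξ, hinv.mono fun γ hγ => ?_⟩
  rw [hαL] at hγ
  rw [GroupoidRep.coboundary, ← hγ, add_sub_cancel_left]
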